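/- Let $\mathcal O$ be a complete discrete valuation ring with fraction field $K$, uniformiser $\pi$ and residue field of characteristic $\neq 2$. Let $G$ be a group and $\rho\colon G\to \mathrm{GL}_2(K)$ an irreducible representation admitting a $G$-stable $\mathcal O$-lattice in $K^2$ (this is automatic if $G$ is compact and $\rho$ is continuous). Let $\mathcal X$ be the Bruhat–Tits tree of $\mathrm{PGL}_2(K)$: its vertices are the homothety classes of lattices in $K^2$, and $x,y$ are adjacent if they have representatives with $\pi\Lambda_x\subsetneq\Lambda_y\subsetneq\Lambda_x$. Let $\mathcal X(\rho)$ be the induced subgraph of $\mathcal X$ on the classes of $G$-stable lattices. For a line segment $S$ in $\mathcal X$ (the vertices of a finite path, possibly a single vertex) and an integer $r\ge 0$, the band $B(S,r)$ of radius $r$ with nerve $S$ is the set of vertices at distance at most $r$ from $S$. A pair of conjugate characters modulo $\pi^n$ is a pair of homomorphisms $\chi_1,\chi_2\colon G\to(\mathcal O/\pi^n\mathcal O)^\times$ such that $\det(t-\rho(g))\equiv (t-\chi_1(g))(t-\chi_2(g)) \pmod{\pi^n}$ for all $g\in G$. For such a pair, $m(\chi_1,\chi_2)$ is the largest integer $m\le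 n$ with $\chi_1\equiv\chi_2\pmod{\pi^m}$. Let $n(\rho)$ be the supremum of the integers $n\ge 0$ for which a pair of conjugate characters modulo $\pi^n$ exists (for $n=0$ the ring is zero and there is exactly one such pair), and, if $n(\rho)$ is finite, let $m(\rho)$ be the maximum of $m(\chi_1,\chi_2)$ over all pairs of conjugate characters modulo $\pi^{n(\rho)}$. Then $n(\rho)$ is finite, and $\mathcal X(\rho)$ is a band whose diameter is $d(\rho)=n(\rho)$ and whose radius $r(\rho)$ (which is uniquely determined by $\mathcal X(\rho)$) is $$r(\rho)=\begin{cases} m(\rho) & \text{if } m(\rho)\neq n(\rho),\\ \left\lfloor m(\rho)/2\right\rfloor & \text{if } m(\rho)=n(\rho).\end{cases}$$ -/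

import Mathlib

open Matrix Polynomial IsLocalRing
open scoped Pointwise

namespace BTTree

noncomputable section

section Tree

set_option linter.unusedSectionVars false

variable (O K : Type*) [CommRing O] [IsDomain O] [IsDiscreteValuationRing O]
  [Field K] [Algebra O K] [IsFractionRing O K]

/-- The `O`-lattices in `K ^ 2`. -/
abbrev Lattice : Type _ :=
  {L : Submodule O (Fin 2 → K) // Submodule.IsLattice K L}

variable {O K}

/-- The lattice `c L`, for `c` in `Kˣ`. -/
def Lattice.scale (c : Kˣ) (L : Lattice O K) : Lattice O K :=
  ⟨c • L.1, haveI := L.2; Submodule.IsLattice.smul K L.1 c⟩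

variable (O K)

/-- Two lattices are homothetic if they differ by a scalar in `Kˣ`. -/
instance homothety : Setoid (Lattice O K) where
  r L M := ∃ c : Kˣ, M = L.scale c
  iseqv :=
    { refl := fun L => ⟨1, Subtype.ext (one_smul Kˣ L.1).symm⟩
      symm := by
        rintro L M ⟨c, rfl⟩
        exact ⟨c⁻¹, Subtype.ext (inv_smul_smul c L.1).symm⟩
      trans := by
        rintro L M N ⟨c, rfl⟩ ⟨d, rfl⟩
        exact ⟨d * c, Subtype.ext (mul_smul d c L.1).symm⟩ }

/-- The vertices of the Bruhat--Tits tree of `PGL_2(K)`: homothety classes of lattices. -/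
def Vertex : Type _ := Quotient (homothety O K)

variable {O K}

/-- The homothety class of a lattice. -/
def Lattice.cls (L : Lattice O K) : Vertex O K := Quotient.mk _ L

theorem Lattice.cls_scale (c : Kˣ) (L : Lattice O K) : (L.scale c).cls = L.cls :=
  Quotient.sound (Setoid.symm ⟨c, rfl⟩)

theorem units_smul_mono (c : Kˣ) {M N : Submodule O (Fin 2 → K)} (h : M ≤ N) : c • M ≤ c • N := by
  intro v hv
  obtain ⟨w, hw, rfl⟩ := Submodule.mem_smul_pointwise_iff_exists v c M |>.1 hv
  exact Submodule.smul_mem_pointwise_smul w c N (h hw)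

theorem algebraMap_smul_le (a : O) (c : Kˣ) (h : algebraMap O K a = c)
    (N : Submodule O (Fin 2 → K)) : c • N ≤ N := by
  intro v hv
  obtain ⟨w, hw, rfl⟩ := Submodule.mem_smul_pointwise_iff_exists v c N |>.1 hv
  have : c • w = a • w := by
    rw [Units.smul_def, ← h, algebraMap_smul]
  rw [this]
  exact N.smul_mem a hw

theorem maximalIdeal_smul_eq {p : O} (hp : Irreducible p) (c : Kˣ) (h : algebraMap O K p = c)
    (N : Submodule O (Fin 2 → K)) : maximalIdeal O • N = c • N := by
  rw [hp.maximalIdeal_eq, Submodule.ideal_span_singleton_smul]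
  ext v
  simp only [Submodule.mem_smul_pointwise_iff_exists, Units.smul_def, ← h, algebraMap_smul]

theorem not_between_homothetic {L M : Lattice O K} (hLM : L.cls = M.cls)
    (h₁ : maximalIdeal O • L.1 < M.1) (h₂ : M.1 < L.1) : False := by
  obtain ⟨p, hp⟩ := IsDiscreteValuationRing.exists_irreducible O
  have hp0 : algebraMap O K p ≠ 0 := by
    simpa using hp.ne_zero
  obtain ⟨c, rfl⟩ := (Quotient.exact hLM : ∃ c : Kˣ, M = L.scale c)
  change _ < c • L.1 at h₁
  change c • L.1 < L.1 at h₂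
  rw [maximalIdeal_smul_eq hp (Units.mk0 _ hp0) rfl] at h₁
  rcases ValuationRing.isInteger_or_isInteger O (c : K) with ⟨a, ha⟩ | ⟨a, ha⟩
  · by_cases hu : IsUnit a
    · obtain ⟨u, rfl⟩ := hu
      have h3 : c⁻¹ • L.1 ≤ L.1 := by
        apply algebraMap_smul_le (↑u⁻¹ : O)
        rw [Units.val_inv_eq_inv_val, ← ha]
        apply eq_inv_of_mul_eq_one_left
        rw [← map_mul]
        simp
      have h4 : c • c⁻¹ • L.1 ≤ c • L.1 := units_smul_mono _ h3
      rw [smul_inv_smul] at h4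
      exact not_le_of_gt h₂ h4
    · have : a ∈ maximalIdeal O := hu
      rw [hp.maximalIdeal_eq, Ideal.mem_span_singleton] at this
      obtain ⟨b, rfl⟩ := this
      have hb0 : algebraMap O K b ≠ 0 := by
        intro hb
        apply c.ne_zero
        rw [← ha, map_mul, hb, mul_zero]
      have hc : c = Units.mk0 _ hp0 * Units.mk0 _ hb0 := by
        ext
        simp [← ha]
      rw [hc, mul_smul] at h₁
      exact not_le_of_gt h₁
        (units_smul_mono _ (algebraMap_smul_le b _ rfl L.1))
  · have h3 : c⁻¹ • L.1 ≤ L.1 := by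
      apply algebraMap_smul_le a
      rw [Units.val_inv_eq_inv_val, ← ha]
    have h4 : c • c⁻¹ • L.1 ≤ c • L.1 := units_smul_mono _ h3
    rw [smul_inv_smul] at h4
    exact not_le_of_gt h₂ h4

variable (O K)

/-- The Bruhat--Tits tree of `PGL_2(K)`: two vertices are adjacent if they have representatives
`L` and `M` with `π L ⊊ M ⊊ L`. -/
def tree : SimpleGraph (Vertex O K) where
  Adj x y := ∃ L M : Lattice O K, L.cls = x ∧ M.cls = y ∧
    maximalIdeal O • L.1 < M.1 ∧ M.1 < L.1
  symm := by
    refine ⟨?_⟩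
    rintro x y ⟨L, M, rfl, rfl, h₁, h₂⟩
    obtain ⟨p, hp⟩ := IsDiscreteValuationRing.exists_irreducible O
    have hp0 : algebraMap O K p ≠ 0 := by
      simpa using hp.ne_zero
    have hN := fun N => maximalIdeal_smul_eq (K := K) hp (Units.mk0 _ hp0) rfl N
    refine ⟨M, L.scale (Units.mk0 _ hp0), rfl, Lattice.cls_scale _ _, ?_, ?_⟩
    · rw [hN]
      refine lt_of_le_not_ge (units_smul_mono _ h₂.le) fun h => ?_
      have h4 := units_smul_mono (Units.mk0 _ hp0)⁻¹ h
      change (Units.mk0 _ hp0)⁻¹ • (Units.mk0 _ hp0) • L.1 ≤ _ at h4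
      rw [inv_smul_smul, inv_smul_smul] at h4
      exact not_le_of_gt h₂ h4
    · rw [hN] at h₁
      exact h₁
  loopless := by
    refine ⟨?_⟩
    rintro x ⟨L, M, hL, hM, h₁, h₂⟩
    exact not_between_homothetic (hL.trans hM.symm) h₁ h₂

variable {O K}

/-- The set of vertices of `X(A)`: the classes of the lattices stable under all matrices in `A`. -/
def stableVertices (A : Set (Matrix (Fin 2) (Fin 2) K)) : Set (Vertex O K) :=
  {x | ∃ L : Lattice O K, L.cls = x ∧ ∀ a ∈ A, ∀ v ∈ L.1, a *ᵥ v ∈ L.1}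

/-- A line segment of the tree: the set of vertices on a finite path (possibly one vertex). -/
def IsSegment (S : Set (Vertex O K)) : Prop :=
  ∃ (x y : Vertex O K) (p : (tree O K).Walk x y), p.IsPath ∧ S = {z | z ∈ p.support}

/-- The band `B(S, r)`: all vertices at distance at most `r` from `S`. -/
def band (S : Set (Vertex O K)) (r : ℕ) : Set (Vertex O K) :=
  {x | ∃ s ∈ S, (tree O K).edist x s ≤ r}

/-- `U` is a band whose nerve is a (finite) line segment and whose radius is `r`. -/
def IsBandOfRadius (U : Set (Vertex O K)) (r : ℕ) : Prop :=
  ∃ S : Set (Vertex O K), IsSegment S ∧ U = band S r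

end Tree

section Representation

variable (O : Type*) {K G : Type*} [CommRing O] [IsDomain O] [IsDiscreteValuationRing O]
  [Field K] [Algebra O K] [IsFractionRing O K] [Group G]

/-- The linear representation of `G` on `K ^ 2` given by `ρ : G → GL_2(K)`. -/
def toRepresentation (ρ : G →* GL (Fin 2) K) : Representation K G (Fin 2 → K) :=
  (Matrix.toLinAlgEquiv' : Matrix (Fin 2) (Fin 2) K ≃ₐ[K] _).toAlgHom.toMonoidHom.comp
    ((Units.coeHom _).comp ρ)

/-- There is a `ρ(G)`-stable lattice in `K ^ 2`. -/
def HasStableLattice (ρ : G →* GL (Fin 2) K) : Prop :=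
  ∃ L : Lattice O K, ∀ g : G, ∀ v ∈ L.1, (ρ g : Matrix (Fin 2) (Fin 2) K) *ᵥ v ∈ L.1

/-- The set of vertices of `X(ρ) = X(ρ(G))`. -/
def fixedVertices (ρ : G →* GL (Fin 2) K) : Set (Vertex O K) :=
  stableVertices (Set.range fun g => (ρ g : Matrix (Fin 2) (Fin 2) K))

/-- The graph `X(ρ)`, an induced subgraph of the tree. -/
def fixedGraph (ρ : G →* GL (Fin 2) K) : SimpleGraph (fixedVertices O ρ) :=
  (tree O K).induce (fixedVertices O ρ)

/-- The characters of `G` modulo `π ^ n`. -/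
abbrev Character (G : Type*) [Group G] (n : ℕ) : Type _ :=
  G →* (O ⧸ maximalIdeal O ^ n)ˣ

variable {O}

/-- `(χ₁, χ₂)` is a pair of conjugate characters modulo `π ^ n` for `ρ`: the characteristic
polynomial of each `ρ(g)` has coefficients in `O` and is congruent to `(t - χ₁(g))(t - χ₂(g))`
modulo `π ^ n`. -/
def IsConjugatePair (ρ : G →* GL (Fin 2) K) {n : ℕ} (χ₁ χ₂ : Character O G n) : Prop :=
  ∀ g : G, ∃ P : O[X],
    P.map (algebraMap O K) = (ρ g : Matrix (Fin 2) (Fin 2) K).charpoly ∧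
    P.map (Ideal.Quotient.mk (maximalIdeal O ^ n)) =
      (X - C (χ₁ g : O ⧸ maximalIdeal O ^ n)) * (X - C (χ₂ g : O ⧸ maximalIdeal O ^ n))

/-- `m(χ₁, χ₂)`: the largest `m ≤ n` such that `χ₁` and `χ₂`, characters modulo `π ^ n`,
are congruent modulo `π ^ m`. -/
def congruenceDepth {n : ℕ} (χ₁ χ₂ : Character O G n) : ℕ :=
  sSup {m : ℕ | m ≤ n ∧ ∀ g : G,
    (χ₁ g : O ⧸ maximalIdeal O ^ n) - (χ₂ g : O ⧸ maximalIdeal O ^ n) ∈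
      (maximalIdeal O ^ m).map (Ideal.Quotient.mk (maximalIdeal O ^ n))}

variable (O)

/-- `n(ρ)`: the supremum of the `n` for which there is a pair of conjugate characters modulo
`π ^ n` (there always is one for `n = 0`, where the quotient ring is zero). -/
def indexN (ρ : G →* GL (Fin 2) K) : ℕ∞ :=
  ⨆ n ∈ {n : ℕ | ∃ χ₁ χ₂ : Character O G n, IsConjugatePair ρ χ₁ χ₂}, (n : ℕ∞)

/-- `m(ρ)`: the maximum of `m(χ₁, χ₂)` over the pairs of conjugate characters modulo
`π ^ n(ρ)`; meaningful if `n(ρ)` is finite. -/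
def indexM (ρ : G →* GL (Fin 2) K) : ℕ :=
  sSup {m : ℕ | ∃ χ₁ χ₂ : Character O G (indexN O ρ).toNat,
    IsConjugatePair ρ χ₁ χ₂ ∧ congruenceDepth χ₁ χ₂ = m}

end Representation

end

end BTTree

/-! In a frame `P`, each conjugated matrix is recorded by its traceless part: the difference `x` of
the diagonal entries, the upper right entry `β` and the lower left entry `γ`. `Level ϖ σ a b c`
bounds the orders of `x`, `β`, `γ` uniformly over the group. The trace is integral and 2 is a unit,
so a vertex is fixed exactly when its level is `(0, 0, 0)`. Level `(c, c, c)` means that every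
matrix is a scalar up to `ϖ ^ c`; this depends only on the vertex and says that the ball of radius
`c` around it is fixed.

Conjugation by `diag(1, ϖ ^ i)` turns level `(a, b, c)` into `(a, b + i, c - i)`. Take `c` maximal
such that level `(c, c, c)` occurs in some frame, then `l` maximal such that `(c, c, c + l)` occurs
(`exists_isExtremal`). In such a frame the vertices at positions `0, ..., l` of the apartment are
precisely the vertices of level `c`, and `X(ρ)` is the band of radius `c` around them
(`IsExtremal.exists_vertex_shift_eq`, `IsExtremal.fixedVertices_eq_band`). Its diameter is `2c + l`.

Characters enter through `disc g h = 2 tr(gh) - tr(g) tr(h)`, which is conjugation invariant and is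
the polar form of `x² + 4βγ`. For a conjugate pair modulo `ϖ ^ n` it is congruent to `B g * B h`
with `B = χ₁ - χ₂`: modulo `ϖ ^ n` it has rank one (`IsSplit`). Conversely, level `(0, 0, n)` yields
a pair read off the diagonal.

The crux is `n ≤ 2c + l` for every splitting (`IsSplit.le_of_extremal`). If `B g` has order exactly
`c` for some `g`, Hensel's lemma makes the discriminant of `g` a square; in an eigenframe of `g` the
rank one condition makes all products `β γ'` divisible by `ϖ ^ n`, and rescaling gives level `(c, c,
n - c)`. If `ϖ ^ (c + 1)` divides all of `B`, the traceless parts divided by `ϖ ^ c` are totally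
isotropic modulo `ϖ`, hence proportional to one nilpotent matrix, and a suitable frame contradicts
the maximality of `c` or `l`. The same diagonalisation, at growing precision, shows that the maxima
exist when no line is stable.

Hence `n(ρ) = 2c + l`. For `m(ρ)`, either `l ≥ 1` and the discriminant has exact order `2c`
somewhere, which forces depth `c` on every pair; or `l ≤ 1` and half of the trace is a character
modulo `ϖ ^ n(ρ)`, so that `m(ρ) = n(ρ)`. -/

namespace BTTree

/-! ### Orders of elements of the fraction field, and Hensel's lemma for squares -/

section OrdGE

set_option linter.unusedSectionVars false

variable {O K : Type*} [CommRing O] [Field K] [Algebra O K]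

/-- `x` lies in the fractional ideal `ϖ ^ n O` of `K`. -/
def OrdGE (ϖ : O) (n : ℤ) (x : K) : Prop :=
  ∃ y : O, x = algebraMap O K ϖ ^ n * algebraMap O K y

variable {ϖ : O} {m n : ℤ} {x y : K}

theorem OrdGE.add (hx : OrdGE ϖ n x) (hy : OrdGE ϖ n y) : OrdGE ϖ n (x + y) := by
  obtain ⟨a, rfl⟩ := hx
  obtain ⟨b, rfl⟩ := hy
  exact ⟨a + b, by rw [map_add]; ring⟩

theorem OrdGE.neg (hx : OrdGE ϖ n x) : OrdGE ϖ n (-x) := by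
  obtain ⟨a, rfl⟩ := hx
  exact ⟨-a, by rw [map_neg]; ring⟩

theorem OrdGE.sub (hx : OrdGE ϖ n x) (hy : OrdGE ϖ n y) : OrdGE ϖ n (x - y) := by
  rw [sub_eq_add_neg]
  exact hx.add hy.neg

theorem OrdGE.zero : OrdGE ϖ n (0 : K) := ⟨0, by simp⟩

theorem OrdGE.of_int (a : O) : OrdGE ϖ 0 (algebraMap O K a) := ⟨a, by simp⟩

theorem OrdGE.one : OrdGE ϖ 0 (1 : K) := ⟨1, by simp⟩

theorem OrdGE.two : OrdGE ϖ 0 (2 : K) := ⟨2, by simp [map_ofNat]⟩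

theorem ordGE_zero_iff : OrdGE ϖ 0 x ↔ ∃ a : O, algebraMap O K a = x := by
  simp [OrdGE, eq_comm]

variable [IsDomain O] [IsDiscreteValuationRing O] [IsFractionRing O K]

theorem algebraMap_uniformizer_ne_zero (hϖ : Irreducible ϖ) : algebraMap O K ϖ ≠ 0 := by
  simpa using hϖ.ne_zero

theorem algebraMap_unit_ne_zero (u : Oˣ) : algebraMap O K u ≠ 0 :=
  (u.isUnit.map (algebraMap O K)).ne_zero

theorem OrdGE.zpow (n : ℤ) : OrdGE ϖ n (algebraMap O K ϖ ^ n) := ⟨1, by simp⟩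

theorem OrdGE.mul (hϖ : Irreducible ϖ) (hx : OrdGE ϖ m x) (hy : OrdGE ϖ n y) :
    OrdGE ϖ (m + n) (x * y) := by
  obtain ⟨a, rfl⟩ := hx
  obtain ⟨b, rfl⟩ := hy
  exact ⟨a * b, by rw [map_mul, zpow_add₀ (algebraMap_uniformizer_ne_zero hϖ)]; ring⟩

theorem OrdGE.mul_of_eq (hϖ : Irreducible ϖ) {k : ℤ} (hx : OrdGE ϖ m x) (hy : OrdGE ϖ n y)
    (h : k = m + n) : OrdGE ϖ k (x * y) := h ▸ hx.mul hϖ hy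

theorem OrdGE.mono (hϖ : Irreducible ϖ) (hx : OrdGE ϖ n x) (h : m ≤ n) : OrdGE ϖ m x := by
  obtain ⟨a, rfl⟩ := hx
  obtain ⟨k, rfl⟩ := Int.le.dest h
  exact ⟨ϖ ^ k * a, by
    rw [map_mul, zpow_add₀ (algebraMap_uniformizer_ne_zero hϖ), map_pow, zpow_natCast]; ring⟩

theorem OrdGE.mul_of_le (hϖ : Irreducible ϖ) {k : ℤ} (hx : OrdGE ϖ m x) (hy : OrdGE ϖ n y)
    (h : k ≤ m + n) : OrdGE ϖ k (x * y) := (hx.mul hϖ hy).mono hϖ h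

/-- `x` is `ϖ ^ n` times a unit. -/
def OrdEq (ϖ : O) (n : ℤ) (x : K) : Prop :=
  ∃ u : Oˣ, x = algebraMap O K ϖ ^ n * algebraMap O K u

theorem OrdEq.ordGE (hx : OrdEq ϖ n x) : OrdGE ϖ n x := by
  obtain ⟨u, rfl⟩ := hx
  exact ⟨u, rfl⟩

theorem OrdEq.ne_zero (hϖ : Irreducible ϖ) (hx : OrdEq ϖ n x) : x ≠ 0 := by
  obtain ⟨u, rfl⟩ := hx
  exact mul_ne_zero (zpow_ne_zero _ (algebraMap_uniformizer_ne_zero hϖ))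
    (algebraMap_unit_ne_zero u)

theorem OrdEq.zpow (n : ℤ) : OrdEq ϖ n (algebraMap O K ϖ ^ n) := ⟨1, by simp⟩

theorem OrdEq.unit (u : Oˣ) : OrdEq ϖ 0 (algebraMap O K u) := ⟨u, by simp⟩

theorem OrdEq.one : OrdEq ϖ 0 (1 : K) := ⟨1, by simp⟩

theorem OrdEq.mul (hϖ : Irreducible ϖ) (hx : OrdEq ϖ m x) (hy : OrdEq ϖ n y) :
    OrdEq ϖ (m + n) (x * y) := by
  obtain ⟨a, rfl⟩ := hx
  obtain ⟨b, rfl⟩ := hy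
  exact ⟨a * b, by
    rw [Units.val_mul, map_mul, zpow_add₀ (algebraMap_uniformizer_ne_zero hϖ)]; ring⟩

theorem OrdEq.neg (hx : OrdEq ϖ n x) : OrdEq ϖ n (-x) := by
  obtain ⟨a, rfl⟩ := hx
  exact ⟨-a, by simp⟩

theorem OrdEq.inv (hx : OrdEq ϖ n x) : OrdEq ϖ (-n) x⁻¹ := by
  obtain ⟨a, rfl⟩ := hx
  refine ⟨a⁻¹, ?_⟩
  rw [mul_inv, _root_.zpow_neg]
  congr 1
  apply inv_eq_of_mul_eq_one_left
  rw [← map_mul]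
  simp

theorem exists_ordEq (hϖ : Irreducible ϖ) (hx : x ≠ 0) : ∃ n : ℤ, OrdEq ϖ n x := by
  obtain ⟨a, b, hb, rfl⟩ := IsFractionRing.div_surjective (A := O) x
  have hb0 : b ≠ 0 := nonZeroDivisors.ne_zero hb
  have ha0 : a ≠ 0 := by
    rintro rfl
    simp at hx
  obtain ⟨i, u, rfl⟩ := IsDiscreteValuationRing.eq_unit_mul_pow_irreducible ha0 hϖ
  obtain ⟨j, v, rfl⟩ := IsDiscreteValuationRing.eq_unit_mul_pow_irreducible hb0 hϖ
  have h (w : Oˣ) (k : ℕ) : OrdEq ϖ (k : ℤ) (algebraMap O K (w * ϖ ^ k)) :=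
    ⟨w, by simp [mul_comm]⟩
  exact ⟨i + -j, by
    rw [div_eq_mul_inv]
    exact (h u i).mul hϖ (h v j).inv⟩

theorem ordGE_zpow_mul_unit_iff (hϖ : Irreducible ϖ) (hx : OrdEq ϖ n x) :
    OrdGE ϖ m x ↔ m ≤ n := by
  refine ⟨fun h => ?_, hx.ordGE.mono hϖ⟩
  by_contra! hlt
  obtain ⟨u, rfl⟩ := hx
  obtain ⟨y, hy⟩ := h
  have h0 := algebraMap_uniformizer_ne_zero (K := K) hϖ
  obtain ⟨k, hk⟩ := Int.le.dest (Int.add_one_le_of_lt hlt)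
  have h1 : algebraMap O K u = algebraMap O K (ϖ * (ϖ ^ k * y)) := by
    apply mul_left_cancel₀ (zpow_ne_zero n h0)
    rw [hy, ← hk, zpow_add₀ h0, zpow_add₀ h0, zpow_one, zpow_natCast, map_mul, map_mul, map_pow]
    ring
  have h2 := IsFractionRing.injective O K h1
  exact hϖ.not_isUnit (isUnit_of_dvd_unit ⟨_, h2⟩ u.isUnit)

theorem exists_ordEq_lt (hϖ : Irreducible ϖ) (hx : ¬ OrdGE ϖ n x) : ∃ k < n, OrdEq ϖ k x := by
  have h0 : x ≠ 0 := by
    rintro rfl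
    exact hx .zero
  obtain ⟨k, hk⟩ := exists_ordEq hϖ h0
  exact ⟨k, by rwa [ordGE_zpow_mul_unit_iff hϖ hk, not_le] at hx, hk⟩

theorem ordEq_of_not_succ (hϖ : Irreducible ϖ) (hx : OrdGE ϖ n x) (h : ¬ OrdGE ϖ (n + 1) x) :
    OrdEq ϖ n x := by
  obtain ⟨k, hk, hkx⟩ := exists_ordEq_lt hϖ h
  rw [ordGE_zpow_mul_unit_iff hϖ hkx] at hx
  obtain rfl : k = n := by omega
  exact hkx

theorem OrdEq.not_succ (hϖ : Irreducible ϖ) (hx : OrdEq ϖ n x) : ¬ OrdGE ϖ (n + 1) x := by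
  rw [ordGE_zpow_mul_unit_iff hϖ hx]
  omega

theorem OrdEq.unique (hϖ : Irreducible ϖ) (hx : OrdEq ϖ n x) (hy : OrdEq ϖ m x) : n = m :=
  le_antisymm ((ordGE_zpow_mul_unit_iff hϖ hy).1 hx.ordGE)
    ((ordGE_zpow_mul_unit_iff hϖ hx).1 hy.ordGE)

/-- Division by an element of known order. -/
theorem OrdGE.of_mul_left (hϖ : Irreducible ϖ) {k : ℤ} (hx : OrdEq ϖ m x)
    (h : OrdGE ϖ k (x * y)) (hn : n ≤ k - m) : OrdGE ϖ n y := by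
  have := h.mul hϖ hx.inv.ordGE
  rw [mul_comm, inv_mul_cancel_left₀ (hx.ne_zero hϖ)] at this
  exact this.mono hϖ (by omega)

/-- The order of a square is even, so half of an odd bound rounds up. The `k + 1` records this; the
gain of one order is what later improves `c` to `c + 1`. -/
theorem OrdGE.of_sq (hϖ : Irreducible ϖ) {k : ℤ} (h : OrdGE ϖ k (x * x)) (hn : 2 * n ≤ k + 1) :
    OrdGE ϖ n x := by
  by_contra hx
  obtain ⟨j, hj, hjx⟩ := exists_ordEq_lt hϖ hx
  rw [ordGE_zpow_mul_unit_iff hϖ (hjx.mul hϖ hjx)] at h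
  omega

/-- If the sum and the product of two elements are divisible by `ϖ ^ n` and `ϖ ^ (2 n)`, then
both are divisible by `ϖ ^ n`. -/
theorem OrdGE.of_add_of_mul (hϖ : Irreducible ϖ) (hs : OrdGE ϖ n (x + y))
    (hp : OrdGE ϖ (2 * n) (x * y)) : OrdGE ϖ n x := by
  by_contra hx
  obtain ⟨j, hj, hjx⟩ := exists_ordEq_lt hϖ hx
  -- If `x` had order `j < n`, both terms of `x (x + y) - x y` would have order above `2j`, the
  -- order of `x²`.
  have h1 : OrdGE ϖ (2 * j + 1) (x * x) := by
    have : x * x = x * (x + y) - x * y := by ring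
    rw [this]
    exact (hjx.ordGE.mul_of_le hϖ hs (by omega)).sub (hp.mono hϖ (by omega))
  rw [ordGE_zpow_mul_unit_iff hϖ (hjx.mul hϖ hjx)] at h1
  omega

theorem OrdGE.add_iff_right (hx : OrdGE ϖ n x) : OrdGE ϖ n (x + y) ↔ OrdGE ϖ n y :=
  ⟨fun h => by simpa using h.sub hx, fun h => hx.add h⟩

theorem ordGE_natCast_iff {n : ℕ} {a : O} :
    OrdGE ϖ n (algebraMap O K a) ↔ ϖ ^ n ∣ a := by
  constructor
  · rintro ⟨y, hy⟩
    refine ⟨y, IsFractionRing.injective O K ?_⟩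
    rw [hy, map_mul, map_pow, zpow_natCast]
  · rintro ⟨y, rfl⟩
    exact ⟨y, by rw [map_mul, map_pow, zpow_natCast]⟩

theorem mem_maximalIdeal_pow_iff (hϖ : Irreducible ϖ) {n : ℕ} {a : O} :
    a ∈ maximalIdeal O ^ n ↔ OrdGE ϖ n (algebraMap O K a) := by
  rw [ordGE_natCast_iff, hϖ.maximalIdeal_eq, Ideal.span_singleton_pow,
    Ideal.mem_span_singleton]

theorem eq_zero_of_forall_ordGE (hϖ : Irreducible ϖ) (h : ∀ N : ℕ, ∃ n ≥ N, OrdGE ϖ (n : ℤ) x) :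
    x = 0 := by
  by_contra hx
  obtain ⟨k, hk⟩ := exists_ordEq hϖ hx
  obtain ⟨n, hn, h⟩ := h (k.toNat + 1)
  rw [ordGE_zpow_mul_unit_iff hϖ hk] at h
  omega

theorem ordEq_two (hchar : ringChar (ResidueField O) ≠ 2) : OrdEq ϖ 0 (2 : K) := by
  have h2 : IsUnit (2 : O) := by
    by_contra h
    have : (2 : O) ∈ maximalIdeal O := h
    rw [← residue_eq_zero_iff, map_ofNat] at this
    exact Ring.two_ne_zero hchar this
  obtain ⟨u, hu⟩ := h2
  exact ⟨u, by simp [hu, map_ofNat]⟩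

/-- A perturbation of a nonzero square is a square, over a complete discrete valuation ring of
residue characteristic different from two. -/
theorem exists_sq_eq [IsAdicComplete (maximalIdeal O) O] (hϖ : Irreducible ϖ)
    (hchar : ringChar (ResidueField O) ≠ 2) {b q : K} {k n : ℤ} (hb : OrdEq ϖ k b)
    (hq : OrdGE ϖ n (q - b * b)) (hn : 2 * k < n) : ∃ t, OrdEq ϖ k t ∧ q = t * t := by
  -- Since `n > 2k`, the quotient `q / b²` is `1 + ϖ z` with `z` integral. Hensel applies to `X² -
  -- (1 + ϖ z)` at `1`, where the derivative is the unit 2.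
  have h1 : OrdGE ϖ 1 ((q - b * b) * (b⁻¹ * b⁻¹)) :=
    hq.mul_of_le hϖ (hb.inv.mul hϖ hb.inv).ordGE (by omega)
  obtain ⟨z, hz⟩ := h1
  have h2 : IsUnit (2 : O) := by
    by_contra h
    have : (2 : O) ∈ maximalIdeal O := h
    rw [← residue_eq_zero_iff, map_ofNat] at this
    exact Ring.two_ne_zero hchar this
  have hmem : ϖ * z ∈ maximalIdeal O := by
    rw [hϖ.maximalIdeal_eq]
    exact Ideal.mem_span_singleton.2 ⟨z, rfl⟩
  obtain ⟨s, hs, hs1⟩ := HenselianRing.is_henselian (I := maximalIdeal O)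
    (X ^ 2 - C (1 + ϖ * z) : O[X])
    (monic_X_pow_sub_C _ two_ne_zero) 1 (by simpa using hmem)
    (by
      simp only [derivative_sub, derivative_X_pow, derivative_C]
      simpa using h2.map (Ideal.Quotient.mk (maximalIdeal O)))
  have hsu : IsUnit s := by
    by_contra h
    have h3 : s ∈ maximalIdeal O := h
    exact (Ideal.ne_top_iff_one _).1 (maximalIdeal.isMaximal O).ne_top
      (by simpa using sub_mem h3 hs1)
  obtain ⟨u, rfl⟩ := hsu
  have hb0 := hb.ne_zero hϖ
  refine ⟨b * algebraMap O K u, by simpa using hb.mul hϖ (OrdEq.unit u), ?_⟩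
  have hs' : (u : O) ^ 2 = 1 + ϖ * z := by
    simpa [IsRoot, sub_eq_zero] using hs
  have hs'' := congrArg (algebraMap O K) hs'
  rw [map_pow, map_add, map_mul, map_one] at hs''
  rw [zpow_one] at hz
  rw [← hz] at hs''
  calc q = b * b * (1 + (q - b * b) * (b⁻¹ * b⁻¹)) := by field_simp; ring
    _ = _ := by rw [← hs'']; ring

end OrdGE

/-! ### Traceless parts under a change of frame, and the discriminant form -/

section Conjugation

variable {K G : Type*} [Field K] [Group G]

/-- The representation `ρ` read in the frame `P`. -/
def conjRep (ρ : G →* GL (Fin 2) K) (P : GL (Fin 2) K) : G →* GL (Fin 2) K :=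
  (MulAut.conj P⁻¹).toMonoidHom.comp ρ

theorem conjRep_apply (ρ : G →* GL (Fin 2) K) (P : GL (Fin 2) K) (g : G) :
    conjRep ρ P g = P⁻¹ * ρ g * P := by
  simp [conjRep]

theorem conjRep_mul (ρ : G →* GL (Fin 2) K) (P k : GL (Fin 2) K) :
    conjRep ρ (P * k) = conjRep (conjRep ρ P) k := by
  ext1 g
  simp [conjRep_apply, mul_assoc]

theorem conjRep_one (ρ : G →* GL (Fin 2) K) : conjRep ρ 1 = ρ := by
  ext1 g
  simp [conjRep_apply]

/-- The invertible matrix with the given entries. -/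
def gl (p q r t : K) (h : p * t - q * r ≠ 0) : GL (Fin 2) K :=
  GeneralLinearGroup.mkOfDetNeZero !![p, q; r, t] (by simpa [det_fin_two])

@[simp] theorem coe_gl (p q r t : K) (h : p * t - q * r ≠ 0) :
    (gl p q r t h : Matrix (Fin 2) (Fin 2) K) = !![p, q; r, t] := rfl

/-- The diagonal matrix with entries `1, s`. -/
def dg (s : K) (hs : s ≠ 0) : GL (Fin 2) K := gl 1 0 0 s (by simpa)

theorem coe_dg (s : K) (hs : s ≠ 0) :
    (dg s hs : Matrix (Fin 2) (Fin 2) K) = !![1, 0; 0, s] := rfl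

variable (σ : G →* GL (Fin 2) K)

/-- The difference of the diagonal entries. -/
def diff (g : G) : K := σ g 0 0 - σ g 1 1

/-- The polar form of the discriminant of the characteristic polynomial. -/
def disc (g h : G) : K :=
  2 * (σ (g * h) : Matrix (Fin 2) (Fin 2) K).trace -
    (σ g : Matrix (Fin 2) (Fin 2) K).trace * (σ h : Matrix (Fin 2) (Fin 2) K).trace

/-- The invariant `disc`, defined by traces alone, is the polar form of `x² + 4βγ` on traceless
parts. This links characters, which see traces, to matrix entries. -/
theorem disc_eq (g h : G) :
    disc σ g h = diff σ g * diff σ h + 2 * (σ g 0 1 * σ h 1 0 + σ g 1 0 * σ h 0 1) := by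
  simp only [disc, diff, map_mul, GeneralLinearGroup.coe_mul, trace_fin_two, mul_apply,
    Fin.sum_univ_two]
  ring

theorem trace_conjRep (P : GL (Fin 2) K) (g : G) :
    (conjRep σ P g : Matrix (Fin 2) (Fin 2) K).trace =
      (σ g : Matrix (Fin 2) (Fin 2) K).trace := by
  rw [conjRep_apply, GeneralLinearGroup.coe_mul, trace_mul_comm, ← GeneralLinearGroup.coe_mul]
  simp [← mul_assoc]

theorem disc_conjRep (P : GL (Fin 2) K) (g h : G) : disc (conjRep σ P) g h = disc σ g h := by
  simp only [disc, trace_conjRep]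

theorem inv_entries (k : GL (Fin 2) K) : (k⁻¹ : Matrix (Fin 2) (Fin 2) K) =
    (k 0 0 * k 1 1 - k 0 1 * k 1 0)⁻¹ • !![k 1 1, - k 0 1; - k 1 0, k 0 0] := by
  rw [Matrix.inv_def, Ring.inverse_eq_inv', det_fin_two, adjugate_fin_two]

theorem det_ne_zero (k : GL (Fin 2) K) : k 0 0 * k 1 1 - k 0 1 * k 1 0 ≠ 0 := by
  rw [← det_fin_two]
  exact GeneralLinearGroup.det_ne_zero k

/-- The right-hand side is a quadratic form in the first column of `k`; it vanishes exactly when `σ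
g` preserves the line of that column. The determinant stands on the left to avoid denominators. -/
theorem conjRep_one_zero (k : GL (Fin 2) K) (g : G) :
    (k 0 0 * k 1 1 - k 0 1 * k 1 0) * conjRep σ k g 1 0 =
      σ g 1 0 * (k 0 0 * k 0 0) - diff σ g * (k 0 0 * k 1 0) - σ g 0 1 * (k 1 0 * k 1 0) := by
  have := det_ne_zero k
  simp only [conjRep_apply, GeneralLinearGroup.coe_mul, GeneralLinearGroup.coe_inv, inv_entries,
    mul_apply, Fin.sum_univ_two, diff]
  simp
  field_simp
  ring

theorem conjRep_zero_one (k : GL (Fin 2) K) (g : G) :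
    (k 0 0 * k 1 1 - k 0 1 * k 1 0) * conjRep σ k g 0 1 =
      σ g 0 1 * (k 1 1 * k 1 1) + diff σ g * (k 0 1 * k 1 1) - σ g 1 0 * (k 0 1 * k 0 1) := by
  have := det_ne_zero k
  simp only [conjRep_apply, GeneralLinearGroup.coe_mul, GeneralLinearGroup.coe_inv, inv_entries,
    mul_apply, Fin.sum_univ_two, diff]
  simp
  field_simp
  ring

theorem diff_conjRep (k : GL (Fin 2) K) (g : G) :
    (k 0 0 * k 1 1 - k 0 1 * k 1 0) * diff (conjRep σ k) g =
      diff σ g * (k 0 0 * k 1 1 + k 0 1 * k 1 0) + σ g 0 1 * (2 * (k 1 0 * k 1 1)) -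
        σ g 1 0 * (2 * (k 0 0 * k 0 1)) := by
  have := det_ne_zero k
  simp only [diff, conjRep_apply, GeneralLinearGroup.coe_mul, GeneralLinearGroup.coe_inv,
    inv_entries, mul_apply, Fin.sum_univ_two]
  simp
  field_simp
  ring

theorem conjRep_dg_zero_one (s : K) (hs : s ≠ 0) (g : G) :
    conjRep σ (dg s hs) g 0 1 = s * σ g 0 1 := by
  have := conjRep_zero_one σ (dg s hs) g
  simp [coe_dg] at this
  apply mul_left_cancel₀ hs
  rw [this]
  ring

theorem conjRep_dg_one_zero (s : K) (hs : s ≠ 0) (g : G) :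
    conjRep σ (dg s hs) g 1 0 = s⁻¹ * σ g 1 0 := by
  have := conjRep_one_zero σ (dg s hs) g
  simp [coe_dg] at this
  rw [← this, inv_mul_cancel_left₀ hs]

theorem diff_conjRep_dg (s : K) (hs : s ≠ 0) (g : G) :
    diff (conjRep σ (dg s hs)) g = diff σ g := by
  have := diff_conjRep σ (dg s hs) g
  simp [coe_dg] at this
  apply mul_left_cancel₀ hs
  rw [this]
  ring

/-- The matrix exchanging the two basis vectors. -/
def swap : GL (Fin 2) K := gl 0 1 1 0 (by simp)

theorem coe_swap : ((swap : GL (Fin 2) K) : Matrix (Fin 2) (Fin 2) K) = !![0, 1; 1, 0] := rfl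

theorem conjRep_swap_zero_one (g : G) : conjRep σ swap g 0 1 = σ g 1 0 := by
  have := conjRep_zero_one σ swap g
  simpa [coe_swap] using this

theorem conjRep_swap_one_zero (g : G) : conjRep σ swap g 1 0 = σ g 0 1 := by
  have := conjRep_one_zero σ swap g
  simpa [coe_swap] using this

theorem diff_conjRep_swap (g : G) : diff (conjRep σ swap) g = - diff σ g := by
  have := diff_conjRep σ swap g
  simp [coe_swap] at this
  rw [← this, neg_neg]

end Conjugation

/-! ### Levels, integral changes of frame and stable lines -/

section Level

set_option linter.unusedSectionVars false

variable {O K G : Type*} [CommRing O] [IsDomain O] [IsDiscreteValuationRing O]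
  [Field K] [Algebra O K] [IsFractionRing O K] [Group G] {ϖ : O}

/-- The orders of the difference of the diagonal entries, of the upper right entry and of the
lower left entry of all matrices `σ(g)` are at least `a`, `b` and `c`. -/
def Level (ϖ : O) (σ : G →* GL (Fin 2) K) (a b c : ℤ) : Prop :=
  ∀ g, OrdGE ϖ a (diff σ g) ∧ OrdGE ϖ b (σ g 0 1) ∧ OrdGE ϖ c (σ g 1 0)

variable {σ : G →* GL (Fin 2) K} {a b c a' b' c' n : ℤ}

theorem Level.mono (hϖ : Irreducible ϖ) (h : Level ϖ σ a b c) (ha : a' ≤ a) (hb : b' ≤ b)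
    (hc : c' ≤ c) : Level ϖ σ a' b' c' := fun g =>
  ⟨(h g).1.mono hϖ ha, (h g).2.1.mono hϖ hb, (h g).2.2.mono hϖ hc⟩

theorem Level.conj_swap (h : Level ϖ σ a b c) : Level ϖ (conjRep σ swap) a c b := fun g => by
  rw [diff_conjRep_swap, conjRep_swap_zero_one, conjRep_swap_one_zero]
  exact ⟨(h g).1.neg, (h g).2.2, (h g).2.1⟩

theorem Level.conj_dg (hϖ : Irreducible ϖ) (h : Level ϖ σ a b c) {s : K} (hs : s ≠ 0)
    (hn : OrdEq ϖ n s) (hb : b' = b + n) (hc : c' = c - n) :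
    Level ϖ (conjRep σ (dg s hs)) a b' c' := fun g => by
  rw [diff_conjRep_dg, conjRep_dg_zero_one, conjRep_dg_one_zero]
  exact ⟨(h g).1, hn.ordGE.mul_of_eq hϖ (h g).2.1 (by omega),
    hn.inv.ordGE.mul_of_eq hϖ (h g).2.2 (by omega)⟩

/-- The diagonal matrix with entries `1, ϖ ^ n`. -/
noncomputable def shift (hϖ : Irreducible ϖ) (n : ℤ) : GL (Fin 2) K :=
  dg (algebraMap O K ϖ ^ n) (zpow_ne_zero _ (algebraMap_uniformizer_ne_zero hϖ))

theorem coe_shift (hϖ : Irreducible ϖ) (n : ℤ) :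
    ((shift hϖ n : GL (Fin 2) K) : Matrix (Fin 2) (Fin 2) K) = !![1, 0; 0, algebraMap O K ϖ ^ n] := rfl

theorem shift_add (hϖ : Irreducible ϖ) (m n : ℤ) :
    (shift hϖ (m + n) : GL (Fin 2) K) = shift hϖ m * shift hϖ n := by
  apply Units.ext
  rw [GeneralLinearGroup.coe_mul]
  simp only [coe_shift]
  simp [zpow_add₀ (algebraMap_uniformizer_ne_zero (K := K) hϖ)]

theorem shift_zero (hϖ : Irreducible ϖ) : (shift hϖ 0 : GL (Fin 2) K) = 1 := by
  apply Units.ext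
  simp [coe_shift, one_fin_two]

theorem Level.conj_shift (hϖ : Irreducible ϖ) (h : Level ϖ σ a b c) (n : ℤ)
    (hb : b' = b + n) (hc : c' = c - n) :
    Level ϖ (conjRep σ (shift hϖ n)) a b' c' :=
  h.conj_dg hϖ _ (OrdEq.zpow n) hb hc

/-- Entries and inverse determinant of the frame change are integral. -/
def IsIntegralFrame (ϖ : O) (k : GL (Fin 2) K) : Prop :=
  (∀ i j, OrdGE ϖ 0 (k i j)) ∧ OrdEq ϖ 0 (k 0 0 * k 1 1 - k 0 1 * k 1 0)

/-- Equal bounds mean that each `σ g` is a scalar plus `ϖ ^ n` times an integral matrix, a condition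
invariant under `GL_2(O)`. -/
theorem Level.of_isIntegralFrame (hϖ : Irreducible ϖ) (h : Level ϖ σ n n n) {k : GL (Fin 2) K}
    (hk : IsIntegralFrame ϖ k) : Level ϖ (conjRep σ k) n n n := fun g => by
  have m (i j i' j' : Fin 2) : OrdGE ϖ 0 (k i j * k i' j') :=
    (hk.1 i j).mul_of_eq hϖ (hk.1 i' j') (by simp)
  have m2 (i j i' j' : Fin 2) : OrdGE ϖ 0 (2 * (k i j * k i' j')) :=
    OrdGE.two.mul_of_eq hϖ (m ..) (by simp)
  obtain ⟨h1, h2, h3⟩ := h g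
  refine ⟨.of_mul_left hϖ (k := n) hk.2 ?_ (by omega), .of_mul_left hϖ (k := n) hk.2 ?_ (by omega),
    .of_mul_left hϖ (k := n) hk.2 ?_ (by omega)⟩
  · rw [diff_conjRep]
    exact ((h1.mul_of_eq hϖ ((m ..).add (m ..)) (by simp)).add
      (h2.mul_of_eq hϖ (m2 ..) (by simp))).sub (h3.mul_of_eq hϖ (m2 ..) (by simp))
  · rw [conjRep_zero_one]
    exact ((h2.mul_of_eq hϖ (m ..) (by simp)).add (h1.mul_of_eq hϖ (m ..) (by simp))).sub
      (h3.mul_of_eq hϖ (m ..) (by simp))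
  · rw [conjRep_one_zero]
    exact ((h3.mul_of_eq hϖ (m ..) (by simp)).sub (h1.mul_of_eq hϖ (m ..) (by simp))).sub
      (h2.mul_of_eq hϖ (m ..) (by simp))

/-- No line is stable. -/
def NoStableLine (σ : G →* GL (Fin 2) K) : Prop :=
  ∀ P : GL (Fin 2) K, ∃ g, conjRep σ P g 1 0 ≠ 0

theorem NoStableLine.conj (h : NoStableLine σ) (P : GL (Fin 2) K) :
    NoStableLine (conjRep σ P) := fun P' => by
  simpa [conjRep_mul] using h (P * P')

theorem NoStableLine.exists_one_zero (h : NoStableLine σ) : ∃ g, σ g 1 0 ≠ 0 := by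
  simpa [conjRep_one] using h 1

theorem NoStableLine.exists_zero_one (h : NoStableLine σ) : ∃ g, σ g 0 1 ≠ 0 := by
  simpa [conjRep_swap_one_zero] using h swap

theorem noStableLine_of_isIrreducible (h : (toRepresentation σ).IsIrreducible) :
    NoStableLine σ := by
  intro P
  by_contra! hP
  have key (g : G) (a : K) : ∃ b : K, (σ g : Matrix (Fin 2) (Fin 2) K) *ᵥ
      ((P : Matrix (Fin 2) (Fin 2) K) *ᵥ ![a, 0]) =
      (P : Matrix (Fin 2) (Fin 2) K) *ᵥ ![b, 0] := by
    refine ⟨conjRep σ P g 0 0 * a, ?_⟩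
    have h1 : σ g * P = P * conjRep σ P g := by simp [conjRep_apply, mul_assoc]
    rw [mulVec_mulVec, ← GeneralLinearGroup.coe_mul, h1, GeneralLinearGroup.coe_mul,
      ← mulVec_mulVec]
    congr 1
    ext i
    fin_cases i <;> simp [mulVec, dotProduct, Fin.sum_univ_two, hP g]
  -- The line spanned by the first column of `P`.
  let W : Subrepresentation (toRepresentation σ) :=
    { toSubmodule := LinearMap.range
        ((Matrix.toLin' (P : Matrix (Fin 2) (Fin 2) K)).comp (LinearMap.single K (fun _ => K) 0))
      apply_mem_toSubmodule := by
        rintro g _ ⟨a, rfl⟩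
        obtain ⟨b, hb⟩ := key g a
        have e (a : K) : (Pi.single 0 a : Fin 2 → K) = ![a, 0] := by
          ext i
          fin_cases i <;> simp
        refine ⟨b, ?_⟩
        simp only [LinearMap.comp_apply, LinearMap.coe_single, e]
        exact hb.symm }
  have e (a : K) : (Pi.single 0 a : Fin 2 → K) = ![a, 0] := by
    ext i
    fin_cases i <;> simp
  have hinj : Function.Injective (Matrix.toLin' (P : Matrix (Fin 2) (Fin 2) K)) := by
    intro v w hvw
    exact mulVec_injective_of_isUnit P.isUnit hvw
  rcases h.eq_bot_or_eq_top W with hW | hW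
  · have h1 : W.toSubmodule = ⊥ := by rw [hW]; rfl
    have h2 : (P : Matrix (Fin 2) (Fin 2) K) *ᵥ ![1, 0] ∈ W.toSubmodule := ⟨1, by simp [e]⟩
    rw [h1, Submodule.mem_bot] at h2
    have := hinj (a₁ := ![1, 0]) (a₂ := 0) (by simpa using h2)
    simpa using congrFun this 0
  · have h1 : W.toSubmodule = ⊤ := by rw [hW]; rfl
    have h2 : (P : Matrix (Fin 2) (Fin 2) K) *ᵥ ![0, 1] ∈ W.toSubmodule := by
      rw [h1]; trivial
    obtain ⟨a, ha⟩ := h2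
    have := hinj (a₁ := Pi.single 0 a) (a₂ := ![0, 1]) (by simpa using ha)
    simpa using congrFun this 1

end Level

/-! ### Splittings of the discriminant form and the bound on their precision -/

section Splitting

set_option linter.unusedSectionVars false

variable {O K G : Type*} [CommRing O] [IsDomain O] [IsDiscreteValuationRing O]
  [Field K] [Algebra O K] [IsFractionRing O K] [Group G] {ϖ : O}
  {σ : G →* GL (Fin 2) K} {c k n : ℤ}

/-- Modulo `ϖ ^ n`, the polar form of the discriminant is the square of the linear form `B`. -/
def IsSplit (ϖ : O) (σ : G →* GL (Fin 2) K) (n : ℤ) (B : G → K) : Prop :=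
  (∀ g, OrdGE ϖ 0 (B g)) ∧ ∀ g h, OrdGE ϖ n (disc σ g h - B g * B h)

theorem IsSplit.conj {B : G → K} (h : IsSplit ϖ σ n B) (P : GL (Fin 2) K) :
    IsSplit ϖ (conjRep σ P) n B := by
  simpa only [IsSplit, disc_conjRep] using h

/-- The matrix `2 σ(g) - tr σ(g)` has rows `(x, 2β)` and `(2γ, -x)` and square `t²`. The columns `(x
+ t, 2γ)` and `(-2β, x + t)` are eigenvectors for `t` and `-t`; their determinant is `2t (x + t)`,
hence the choice of sign of `t`. -/
theorem exists_eigenframe (h2 : (2 : K) ≠ 0) {g : G} {t : K} (ht : t ≠ 0)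
    (hg : disc σ g g = t * t) :
    ∃ P, conjRep σ P g 0 1 = 0 ∧ conjRep σ P g 1 0 = 0 := by
  wlog hx : diff σ g + t ≠ 0 generalizing t
  · refine this (t := -t) (neg_ne_zero.2 ht) (by rw [hg]; ring) fun h => ?_
    push Not at hx
    apply mul_ne_zero h2 ht
    linear_combination hx - h
  rw [disc_eq] at hg
  set x := diff σ g with hxdef
  have hdet : (x + t) * (x + t) - (-2 * σ g 0 1) * (2 * σ g 1 0) ≠ 0 := by
    have : (x + t) * (x + t) - (-2 * σ g 0 1) * (2 * σ g 1 0) = 2 * t * (x + t) := by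
      linear_combination hg
    rw [this]
    exact mul_ne_zero (mul_ne_zero h2 ht) hx
  refine ⟨gl (x + t) (-2 * σ g 0 1) (2 * σ g 1 0) (x + t) hdet, ?_, ?_⟩
  · have := conjRep_zero_one σ (gl (x + t) (-2 * σ g 0 1) (2 * σ g 1 0) (x + t) hdet) g
    rw [← hxdef] at this
    simp only [coe_gl, of_apply, cons_val', cons_val_zero, cons_val_one, cons_val_fin_one] at this
    refine (mul_eq_zero.1 (this.trans ?_)).resolve_left hdet
    linear_combination -(σ g 0 1) * hg
  · have := conjRep_one_zero σ (gl (x + t) (-2 * σ g 0 1) (2 * σ g 1 0) (x + t) hdet) g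
    rw [← hxdef] at this
    simp only [coe_gl, of_apply, cons_val', cons_val_zero, cons_val_one, cons_val_fin_one] at this
    refine (mul_eq_zero.1 (this.trans ?_)).resolve_left hdet
    linear_combination -(σ g 1 0) * hg

/-- If `g` is diagonal, then the products of the off-diagonal entries of the other matrices are
as divisible as the failure of the discriminant form to have rank one. -/
theorem IsSplit.offdiag (hϖ : Irreducible ϖ) (h2 : OrdEq ϖ 0 (2 : K)) {B : G → K}
    (hB : IsSplit ϖ σ n B) (hBc : ∀ g, OrdGE ϖ c (B g)) (hn : 2 * c ≤ n) {g : G}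
    (h01 : σ g 0 1 = 0) (h10 : σ g 1 0 = 0) (hg : OrdEq ϖ k (diff σ g)) (h h' : G) :
    OrdGE ϖ (n + 2 * c - 2 * k) (σ h 0 1 * σ h' 1 0) := by
  have key (h h' : G) :
      OrdGE ϖ (n + 2 * c - 2 * k) (σ h 0 1 * σ h' 1 0 + σ h 1 0 * σ h' 0 1) := by
    have hd := ((hg.mul hϖ hg).mul hϖ h2)
    refine OrdGE.of_mul_left (k := n + 2 * c) hϖ hd ?_ (by omega)
    -- As `g` is diagonal, a two by two minor of the Gram matrix of `disc` isolates the off-diagonal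
    -- entries. The same minor of `B ⊗ B` vanishes, so every remaining term contains an error of
    -- order `n` and a factor of order at least `2c`.
    have e1 : diff σ g * diff σ g * 2 * (σ h 0 1 * σ h' 1 0 + σ h 1 0 * σ h' 0 1) =
        disc σ g g * disc σ h h' - disc σ g h * disc σ g h' := by
      simp only [disc_eq, h01, h10]
      ring
    have e2 : disc σ g g * disc σ h h' - disc σ g h * disc σ g h' =
        (B g * B g) * (disc σ h h' - B h * B h') + (B h * B h') * (disc σ g g - B g * B g) +
        (disc σ g g - B g * B g) * (disc σ h h' - B h * B h') -
        (B g * B h) * (disc σ g h' - B g * B h') - (B g * B h') * (disc σ g h - B g * B h) -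
        (disc σ g h - B g * B h) * (disc σ g h' - B g * B h') := by ring
    rw [e1, e2]
    have hb (i j : G) : OrdGE ϖ (2 * c) (B i * B j) := (hBc i).mul_of_le hϖ (hBc j) (by omega)
    have he := hB.2
    have t1 (i j i' j' : G) : OrdGE ϖ (n + 2 * c) ((B i * B j) * (disc σ i' j' - B i' * B j')) :=
      (hb i j).mul_of_le hϖ (he i' j') (by omega)
    have t2 (i j i' j' : G) : OrdGE ϖ (n + 2 * c)
        ((disc σ i j - B i * B j) * (disc σ i' j' - B i' * B j')) :=
      (he i j).mul_of_le hϖ (he i' j') (by omega)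
    exact (((((t1 ..).add (t1 ..)).add (t2 ..)).sub (t1 ..)).sub (t1 ..)).sub (t2 ..)
  have diag (h : G) : OrdGE ϖ (n + 2 * c - 2 * k) (σ h 0 1 * σ h 1 0) := by
    refine OrdGE.of_mul_left (k := n + 2 * c - 2 * k) hϖ h2 ?_ (by omega)
    convert key h h using 1
    ring
  -- The sum `β γ' + γ β'` is controlled by `key`, and the product of its terms regroups as
  -- `(βγ)(β'γ')`, controlled by the diagonal case.
  refine OrdGE.of_add_of_mul hϖ (key h h') ?_
  have : σ h 0 1 * σ h' 1 0 * (σ h 1 0 * σ h' 0 1) =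
    (σ h 0 1 * σ h 1 0) * (σ h' 0 1 * σ h' 1 0) := by ring
  rw [this]
  exact (diag h).mul_of_eq hϖ (diag h') (by ring)

/-- If the products of the off-diagonal entries are divisible by `ϖ ^ n`, then this divisibility
can be moved to the lower left entry. -/
theorem exists_level_of_offdiag (hϖ : Irreducible ϖ) (hirr : NoStableLine σ)
    (hx : ∀ g, OrdGE ϖ c (diff σ g)) (hoff : ∀ h h', OrdGE ϖ n (σ h 0 1 * σ h' 1 0)) :
    ∃ P, Level ϖ (conjRep σ P) c c (n - c) := by
  obtain ⟨g, hg⟩ := hirr.exists_one_zero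
  obtain ⟨j, hj⟩ := exists_ordEq hϖ hg
  have hlow (h : G) : OrdGE ϖ (n - j) (σ h 0 1) := by
    refine OrdGE.of_mul_left (k := n) hϖ hj ?_ (by omega)
    rw [mul_comm]
    exact hoff h g
  -- The least order of an upper right entry is sought. It is at least `n - j`, so it is written `n
  -- - j + i` with `i` natural.
  have hex : ∃ i : ℕ, ∃ h, OrdEq ϖ (n - j + i) (σ h 0 1) := by
    obtain ⟨h, hh⟩ := hirr.exists_zero_one
    obtain ⟨i, hi⟩ := exists_ordEq hϖ hh
    have := (ordGE_zpow_mul_unit_iff hϖ hi).1 (hlow h)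
    refine ⟨(i - (n - j)).toNat, h, ?_⟩
    convert hi using 1
    omega
  classical
  set i := Nat.find hex with hidef
  obtain ⟨h₀, hh₀⟩ := Nat.find_spec hex
  rw [← hidef] at hh₀
  have hmin (h : G) : OrdGE ϖ (n - j + i) (σ h 0 1) := by
    by_contra hh
    obtain ⟨m, hm, hmh⟩ := exists_ordEq_lt hϖ hh
    have := (ordGE_zpow_mul_unit_iff hϖ hmh).1 (hlow h)
    refine Nat.find_min hex (m := (m - (n - j)).toNat) (by omega) ⟨h, ?_⟩
    convert hmh using 1
    omega
  -- The minimum is attained at `h₀`; dividing `β(h₀) γ(h)` by `β(h₀)` bounds all lower left entries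
  -- at once.
  have hlevel : Level ϖ σ c (n - j + i) (j - i) := fun h =>
    ⟨hx h, hmin h, OrdGE.of_mul_left (k := n) hϖ hh₀ (hoff h₀ h) (by omega)⟩
  exact ⟨_, hlevel.conj_shift hϖ (c - (n - j + i)) (by ring) (by ring)⟩

/-- If every `disc g g` vanished, each `B` would be small and the polar form would vanish
identically. The traceless parts would then span a totally isotropic space for `x² + 4βγ`, so they
would be multiples of one nilpotent matrix, whose kernel is a stable line. -/
theorem exists_disc_ne_zero (hϖ : Irreducible ϖ) (h2 : (2 : K) ≠ 0) (hirr : NoStableLine σ)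
    (h : ∀ N : ℕ, ∃ n ≥ N, ∃ B : G → K, IsSplit ϖ σ n B) : ∃ g, disc σ g g ≠ 0 := by
  by_contra! hg
  have h0 (g h' : G) : disc σ g h' = 0 := by
    refine eq_zero_of_forall_ordGE hϖ fun N => ?_
    obtain ⟨n, hn, B, hB⟩ := h (2 * N)
    refine ⟨N, le_rfl, ?_⟩
    have hBN (i : G) : OrdGE ϖ N (B i) := by
      refine OrdGE.of_sq (k := n) hϖ ?_ (by omega)
      have := (hB.2 i i).neg
      simpa [hg] using this
    have := ((hB.2 g h').mono hϖ (m := N) (by omega)).add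
      ((hBN g).mul_of_le hϖ (hBN h') (k := N) (by omega))
    simpa using this
  obtain ⟨g, hγ⟩ := hirr.exists_one_zero
  -- The first column `(x, 2γ)` spans the kernel of `2 σ(g) - tr σ(g)`, since `x² + 4βγ = 0`.
  have hdet : diff σ g * 0 - 1 * (2 * σ g 1 0) ≠ 0 := by
    simpa using ⟨h2, hγ⟩
  obtain ⟨h', hh'⟩ := hirr (gl (diff σ g) 1 (2 * σ g 1 0) 0 hdet)
  apply hh'
  have := conjRep_one_zero σ (gl (diff σ g) 1 (2 * σ g 1 0) 0 hdet) h'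
  simp only [coe_gl, of_apply, cons_val', cons_val_zero, cons_val_one, cons_val_fin_one] at this
  refine (mul_eq_zero.1 (this.trans ?_)).resolve_left hdet
  have e1 := h0 g g
  have e2 := h0 g h'
  rw [disc_eq] at e1 e2
  linear_combination (σ h' 1 0) * e1 - 2 * σ g 1 0 * e2

/-- Below the precision `n`, the elements `disc g g` and `(B g)²` have the same order, which is
therefore even. -/
theorem IsSplit.ordEq_of_disc (hϖ : Irreducible ϖ) {B : G → K} (hB : IsSplit ϖ σ n B) {g : G}
    {m : ℤ} (hm : OrdEq ϖ m (disc σ g g)) (hmn : m < n) :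
    ∃ j, m = 2 * j ∧ OrdEq ϖ j (B g) := by
  have h1 : OrdEq ϖ m (B g * B g) := by
    have e : B g * B g = disc σ g g - (disc σ g g - B g * B g) := by ring
    refine ordEq_of_not_succ hϖ ?_ fun h => hm.not_succ hϖ ?_
    · rw [e]
      exact hm.ordGE.sub ((hB.2 g g).mono hϖ hmn.le)
    · have := h.add ((hB.2 g g).mono hϖ (m := m + 1) (by omega))
      simpa using this
  have h0 : B g ≠ 0 := left_ne_zero_of_mul (h1.ne_zero hϖ)
  obtain ⟨j, hj⟩ := exists_ordEq hϖ h0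
  exact ⟨j, by rw [h1.unique hϖ (hj.mul hϖ hj)]; ring, hj⟩

/-- An irreducible representation is not split to arbitrarily high precision. -/
theorem not_forall_isSplit [IsAdicComplete (maximalIdeal O) O] (hϖ : Irreducible ϖ)
    (hchar : ringChar (ResidueField O) ≠ 2) (hirr : NoStableLine σ) :
    ¬ ∀ N : ℕ, ∃ n ≥ N, ∃ B : G → K, IsSplit ϖ σ n B := by
  intro h
  have h2 : OrdEq ϖ 0 (2 : K) := ordEq_two hchar
  obtain ⟨g, hg⟩ := exists_disc_ne_zero hϖ (h2.ne_zero hϖ) hirr h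
  obtain ⟨m, hm⟩ := exists_ordEq hϖ hg
  -- A precision beyond the order `m` of `disc g g` makes it a square, so `g` can be diagonalised
  -- once and for all.
  obtain ⟨n, hn, B, hB⟩ := h (m.toNat + 1)
  obtain ⟨j, rfl, hj⟩ := hB.ordEq_of_disc hϖ hm (by omega)
  obtain ⟨t, ht, htg⟩ := exists_sq_eq hϖ hchar hj (hB.2 g g) (by omega)
  obtain ⟨P, h01, h10⟩ := exists_eigenframe (h2.ne_zero hϖ) (ht.ne_zero hϖ) htg
  have hd0 : diff (conjRep σ P) g ≠ 0 := by
    intro h0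
    apply hg
    rw [← disc_conjRep σ P, disc_eq, h01, h10, h0]
    ring
  obtain ⟨k, hk⟩ := exists_ordEq hϖ hd0
  obtain ⟨i, hi⟩ := (hirr.conj P).exists_zero_one
  obtain ⟨i', hi'⟩ := (hirr.conj P).exists_one_zero
  refine mul_ne_zero hi hi' (eq_zero_of_forall_ordGE hϖ fun N => ?_)
  -- The extra `2k` compensates for the loss in `IsSplit.offdiag`; here `k` no longer depends on the
  -- precision.
  obtain ⟨n, hn, B, hB⟩ := h (N + (2 * k).toNat)
  refine ⟨N, le_rfl, ?_⟩
  exact ((hB.conj P).offdiag hϖ h2 (c := 0) hB.1 (by omega) h01 h10 hk i i').mono hϖ (by omega)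

/-- In the eigenframe of `g` the diagonal difference is a square root of `disc g g`, of order
exactly `c`. So `IsSplit.offdiag` loses nothing, and `disc g i` recovers the diagonal difference of
every `i`. -/
theorem IsSplit.exists_level [IsAdicComplete (maximalIdeal O) O] (hϖ : Irreducible ϖ)
    (hchar : ringChar (ResidueField O) ≠ 2) (hirr : NoStableLine σ) {B : G → K}
    (hB : IsSplit ϖ σ n B) (hBc : ∀ g, OrdGE ϖ c (B g)) (hn : 2 * c < n) {g : G}
    (hg : OrdEq ϖ c (B g)) : ∃ P, Level ϖ (conjRep σ P) c c (n - c) := by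
  have h2 : OrdEq ϖ 0 (2 : K) := ordEq_two hchar
  obtain ⟨t, ht, htg⟩ := exists_sq_eq hϖ hchar hg (hB.2 g g) (by omega)
  obtain ⟨P, h01, h10⟩ := exists_eigenframe (h2.ne_zero hϖ) (ht.ne_zero hϖ) htg
  have hdt : diff (conjRep σ P) g * diff (conjRep σ P) g = t * t := by
    rw [← htg, ← disc_conjRep σ P, disc_eq, h01, h10]
    ring
  have hd : OrdEq ϖ c (diff (conjRep σ P) g) := by
    rcases mul_self_eq_mul_self_iff.1 hdt with h | h <;> rw [h]
    exacts [ht, ht.neg]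
  have hB' := hB.conj P
  have hoff (i i' : G) : OrdGE ϖ n (conjRep σ P i 0 1 * conjRep σ P i' 1 0) := by
    convert hB'.offdiag hϖ h2 hBc (by omega) h01 h10 hd i i' using 1
    ring
  have hx (i : G) : OrdGE ϖ c (diff (conjRep σ P) i) := by
    refine OrdGE.of_mul_left (k := 2 * c) hϖ hd ?_ (by omega)
    have e : diff (conjRep σ P) g * diff (conjRep σ P) i =
        (disc (conjRep σ P) g i - B g * B i) + B g * B i := by
      rw [disc_eq, h01, h10]
      ring
    rw [e]
    exact ((hB'.2 g i).mono hϖ hn.le).add ((hBc g).mul_of_le hϖ (hBc i) (by omega))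
  obtain ⟨P', hP'⟩ := exists_level_of_offdiag hϖ (hirr.conj P) hx hoff
  exact ⟨P * P', by rwa [conjRep_mul]⟩

/-- Divided by `ϖ ^ c`, the traceless parts are totally isotropic modulo `ϖ`, hence all proportional
to that of `g`, which is nilpotent modulo `ϖ`. A lower unipotent change of frame puts it in the
upper right corner. -/
theorem Level.exists_of_ordEq (hϖ : Irreducible ϖ) (h2 : OrdEq ϖ 0 (2 : K))
    (h : Level ϖ σ c c c) (hk1 : 1 ≤ k) (hk2 : k ≤ 2)
    (hdisc : ∀ g h, OrdGE ϖ (2 * c + k) (disc σ g h)) {g : G} (hg : OrdEq ϖ c (σ g 0 1)) :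
    ∃ P, Level ϖ (conjRep σ P) (c + 1) c (c + k) := by
  have hβ := hg.ne_zero hϖ
  have h20 := h2.ne_zero hϖ
  -- This `s` solves `x + 2βs = 0`, so the diagonal difference of `g` vanishes in the new frame.
  set s : K := - diff σ g * (2 * σ g 0 1)⁻¹ with hs
  have hsO : OrdGE ϖ 0 s := (h g).1.neg.mul_of_eq hϖ (h2.mul hϖ hg).inv.ordGE (by ring)
  have hdet : (1 : K) * 1 - 0 * s ≠ 0 := by simp
  have hP : IsIntegralFrame ϖ (gl 1 0 s 1 hdet) := by
    constructor
    · intro i j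
      fin_cases i <;> fin_cases j <;> simp [OrdGE.one, OrdGE.zero, hsO]
    · simp [OrdEq.one]
  refine ⟨gl 1 0 s 1 hdet, ?_⟩
  have hx0 : diff (conjRep σ (gl 1 0 s 1 hdet)) g = 0 := by
    have := diff_conjRep σ (gl 1 0 s 1 hdet) g
    simp only [coe_gl, of_apply, cons_val', cons_val_zero, cons_val_one, cons_val_fin_one,
      mul_one, one_mul, zero_mul, mul_zero, sub_zero, add_zero] at this
    rw [this, hs]
    field_simp
    ring
  have hβ' : OrdEq ϖ c (conjRep σ (gl 1 0 s 1 hdet) g 0 1) := by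
    have := conjRep_zero_one σ (gl 1 0 s 1 hdet) g
    simp only [coe_gl, of_apply, cons_val', cons_val_zero, cons_val_one, cons_val_fin_one,
      mul_one, one_mul, zero_mul, mul_zero, sub_zero, add_zero] at this
    rwa [this]
  have hL := h.of_isIntegralFrame hϖ hP
  have hdisc' : ∀ i j, OrdGE ϖ (2 * c + k) (disc (conjRep σ (gl 1 0 s 1 hdet)) i j) := by
    simpa only [disc_conjRep] using hdisc
  generalize conjRep σ (gl 1 0 s 1 hdet) = τ at hx0 hβ' hL hdisc'
  -- With `x = 0`, `disc g g` is `4βγ` and `β` has exact order `c`. Pairing with `g` then bounds all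
  -- other lower left entries, and `disc i i` bounds the differences.
  have hγ : OrdGE ϖ (c + k) (τ g 1 0) := by
    refine OrdGE.of_mul_left (k := 2 * c + k) hϖ ((h2.mul hϖ h2).mul hϖ hβ') ?_ (by omega)
    convert hdisc' g g using 1
    rw [disc_eq, hx0]
    ring
  have hγ' (i : G) : OrdGE ϖ (c + k) (τ i 1 0) := by
    refine OrdGE.of_mul_left (k := 2 * c + k) hϖ (h2.mul hϖ hβ') ?_ (by omega)
    have e : 2 * τ g 0 1 * τ i 1 0 = disc τ g i - 2 * (τ g 1 0 * τ i 0 1) := by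
      rw [disc_eq, hx0]
      ring
    rw [e]
    exact (hdisc' g i).sub (OrdGE.two.mul_of_eq hϖ (hγ.mul hϖ (hL i).2.1) (by ring))
  refine fun i => ⟨OrdGE.of_sq (k := 2 * c + k) hϖ ?_ (by omega), (hL i).2.1, hγ' i⟩
  have e : diff τ i * diff τ i = disc τ i i - 2 * (2 * (τ i 0 1 * τ i 1 0)) := by
    rw [disc_eq]
    ring
  rw [e]
  exact (hdisc' i i).sub (OrdGE.two.mul_of_eq hϖ
    (OrdGE.two.mul hϖ ((hL i).2.1.mul hϖ (hγ' i))) (by ring))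

/-- An off-diagonal entry must have exact order `c`: otherwise `x² = disc - 4βγ` would have order at
least `2c + 1`, and `x` order at least `c + 1`. A swap brings the entry to the upper right. -/
theorem Level.exists_of_disc (hϖ : Irreducible ϖ) (h2 : OrdEq ϖ 0 (2 : K))
    (h : Level ϖ σ c c c) (hk1 : 1 ≤ k) (hk2 : k ≤ 2)
    (hdisc : ∀ g h, OrdGE ϖ (2 * c + k) (disc σ g h))
    (hnot : ¬ Level ϖ σ (c + 1) (c + 1) (c + 1)) :
    ∃ P, Level ϖ (conjRep σ P) (c + 1) c (c + k) := by
  by_cases h01 : ∃ g, ¬ OrdGE ϖ (c + 1) (σ g 0 1)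
  · obtain ⟨g, hg⟩ := h01
    exact h.exists_of_ordEq hϖ h2 hk1 hk2 hdisc (ordEq_of_not_succ hϖ (h g).2.1 hg)
  by_cases h10 : ∃ g, ¬ OrdGE ϖ (c + 1) (σ g 1 0)
  · obtain ⟨g, hg⟩ := h10
    obtain ⟨P, hP⟩ := h.conj_swap.exists_of_ordEq hϖ h2 hk1 hk2
      (by simpa only [disc_conjRep] using hdisc) (g := g)
      (by rw [conjRep_swap_zero_one]; exact ordEq_of_not_succ hϖ (h g).2.2 hg)
    exact ⟨swap * P, by rwa [conjRep_mul]⟩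
  push Not at h01 h10
  refine absurd (fun g => ⟨?_, h01 g, h10 g⟩) hnot
  refine OrdGE.of_sq (k := 2 * c + 1) hϖ ?_ (by omega)
  have e : diff σ g * diff σ g = disc σ g g - 2 * (2 * (σ g 0 1 * σ g 1 0)) := by
    rw [disc_eq]
    ring
  rw [e]
  exact ((hdisc g g).mono hϖ (by omega)).sub (OrdGE.two.mul_of_eq hϖ
    (OrdGE.two.mul hϖ ((h01 g).mul_of_le hϖ (h g).2.2 (k := 2 * c + 1) (by omega))) (by ring))

/-- The precision of a splitting is bounded by the extremal levels. -/
theorem IsSplit.le_of_extremal [IsAdicComplete (maximalIdeal O) O] (hϖ : Irreducible ϖ)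
    (hchar : ringChar (ResidueField O) ≠ 2) (hirr : NoStableLine σ) {l : ℤ} (hl0 : 0 ≤ l)
    (h : Level ϖ σ c c c) (hc : ∀ P, ¬ Level ϖ (conjRep σ P) (c + 1) (c + 1) (c + 1))
    (hl : ∀ P, ¬ Level ϖ (conjRep σ P) c c (c + l + 1)) {B : G → K}
    (hB : IsSplit ϖ σ n B) : n ≤ 2 * c + l := by
  have h2 : OrdEq ϖ 0 (2 : K) := ordEq_two hchar
  by_contra! hn
  have hQ (g h' : G) : OrdGE ϖ (2 * c) (disc σ g h') := by
    rw [disc_eq]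
    exact ((h g).1.mul_of_eq hϖ (h h').1 (by ring)).add (OrdGE.two.mul_of_eq hϖ
      (((h g).2.1.mul hϖ (h h').2.2).add ((h g).2.2.mul hϖ (h h').2.1)) (by ring))
  have hBc (g : G) : OrdGE ϖ c (B g) := by
    refine OrdGE.of_sq (k := 2 * c) hϖ ?_ (by omega)
    have e : B g * B g = disc σ g g - (disc σ g g - B g * B g) := by ring
    rw [e]
    exact (hQ g g).sub ((hB.2 g g).mono hϖ (by omega))
  -- If `B` has exact order `c` somewhere, diagonalisation applies; otherwise the discriminant form
  -- is degenerate to higher order.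
  by_cases hex : ∃ g, ¬ OrdGE ϖ (c + 1) (B g)
  · obtain ⟨g, hg⟩ := hex
    obtain ⟨P, hP⟩ := hB.exists_level hϖ hchar hirr hBc (by omega)
      (ordEq_of_not_succ hϖ (hBc g) hg)
    exact hl P (hP.mono hϖ le_rfl le_rfl (by omega))
  push Not at hex
  have hdisc {k : ℤ} (hk : k ≤ 2) (hkn : 2 * c + k ≤ n) (g h' : G) :
      OrdGE ϖ (2 * c + k) (disc σ g h') := by
    have e : disc σ g h' = (disc σ g h' - B g * B h') + B g * B h' := by ring
    rw [e]
    exact ((hB.2 g h').mono hϖ hkn).add ((hex g).mul_of_le hϖ (hex h') (by omega))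
  have hnot : ¬ Level ϖ σ (c + 1) (c + 1) (c + 1) := by simpa [conjRep_one] using hc 1
  -- In the first case `n = 2c + 1` and `l = 0`, and one extra order in the lower left contradicts
  -- the maximality of `l`. In the second, two extra orders are shared by a shift and contradict the
  -- maximality of `c`.
  rcases lt_or_ge n (2 * c + 2) with hn2 | hn2
  · obtain ⟨P, hP⟩ := h.exists_of_disc hϖ h2 le_rfl one_le_two
      (hdisc one_le_two (by omega)) hnot
    exact hl P (hP.mono hϖ (by omega) le_rfl (by omega))
  · obtain ⟨P, hP⟩ := h.exists_of_disc hϖ h2 one_le_two le_rfl (hdisc le_rfl hn2) hnot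
    refine hc (P * shift hϖ 1) ?_
    rw [conjRep_mul]
    exact hP.conj_shift hϖ 1 (by ring) (by ring)

end Splitting

/-! ### Conjugate characters and the values of `n(ρ)` and `m(ρ)` -/

section Characters

set_option linter.unusedSectionVars false

variable {O K G : Type*} [CommRing O] [IsDomain O] [IsDiscreteValuationRing O]
  [Field K] [Algebra O K] [IsFractionRing O K] [Group G] {ϖ : O}
  {σ : G →* GL (Fin 2) K} {n : ℕ}

theorem isConjugatePair_iff {χ₁ χ₂ : Character O G n} :
    IsConjugatePair σ χ₁ χ₂ ↔ ∀ g, ∃ s d : O,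
      algebraMap O K s = (σ g : Matrix (Fin 2) (Fin 2) K).trace ∧
      algebraMap O K d = (σ g : Matrix (Fin 2) (Fin 2) K).det ∧
      Ideal.Quotient.mk (maximalIdeal O ^ n) s = χ₁ g + χ₂ g ∧
      Ideal.Quotient.mk (maximalIdeal O ^ n) d = χ₁ g * χ₂ g := by
  refine forall_congr' fun g => ⟨?_, ?_⟩
  · rintro ⟨p, hp1, hp2⟩
    rw [charpoly_fin_two] at hp1
    have e : (X - C (χ₁ g : O ⧸ maximalIdeal O ^ n)) * (X - C (χ₂ g : O ⧸ maximalIdeal O ^ n)) =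
        X ^ 2 - C (χ₁ g + χ₂ g : O ⧸ maximalIdeal O ^ n) * X +
          C (χ₁ g * χ₂ g : O ⧸ maximalIdeal O ^ n) := by
      rw [C_add, C_mul]
      ring
    rw [e] at hp2
    refine ⟨- p.coeff 1, p.coeff 0, ?_, ?_, ?_, ?_⟩
    · rw [map_neg, ← coeff_map, hp1]
      simp [coeff_X_pow, coeff_C]
    · rw [← coeff_map, hp1]
      simp [coeff_X_pow]
    · rw [map_neg, ← coeff_map, hp2]
      simp [coeff_X_pow, coeff_C, add_mul]
    · rw [← coeff_map, hp2]
      simp [coeff_X_pow]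
  · rintro ⟨s, d, h1, h2, h3, h4⟩
    refine ⟨X ^ 2 - C s * X + C d, ?_, ?_⟩
    · rw [charpoly_fin_two]
      simp [h1, h2]
    · simp only [Polynomial.map_add, Polynomial.map_sub, Polynomial.map_mul, Polynomial.map_pow,
        map_X, map_C, h3, h4, C_add, C_mul]
      ring

theorem det_conjRep (P : GL (Fin 2) K) (g : G) :
    (conjRep σ P g : Matrix (Fin 2) (Fin 2) K).det =
      (σ g : Matrix (Fin 2) (Fin 2) K).det := by
  rw [conjRep_apply, GeneralLinearGroup.coe_mul, det_mul_comm, ← GeneralLinearGroup.coe_mul]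
  simp [← mul_assoc]

theorem isConjugatePair_conjRep {P : GL (Fin 2) K} {χ₁ χ₂ : Character O G n} :
    IsConjugatePair (conjRep σ P) χ₁ χ₂ ↔ IsConjugatePair σ χ₁ χ₂ := by
  simp only [isConjugatePair_iff, trace_conjRep, det_conjRep]

theorem mk_eq_zero_iff (hϖ : Irreducible ϖ) {a : O} :
    Ideal.Quotient.mk (maximalIdeal O ^ n) a = 0 ↔ OrdGE ϖ n (algebraMap O K a) := by
  rw [Ideal.Quotient.eq_zero_iff_mem, mem_maximalIdeal_pow_iff (K := K) hϖ]

/-- If the trace is `χ₁ + χ₂`, multiplicativity turns `2 tr(gh) - tr(g) tr(h)` into `(χ₁ - χ₂)(g)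
(χ₁ - χ₂)(h)`. -/
theorem IsConjugatePair.exists_isSplit (hϖ : Irreducible ϖ) {χ₁ χ₂ : Character O G n}
    (h : IsConjugatePair σ χ₁ χ₂) :
    ∃ b : G → O, (∀ g, Ideal.Quotient.mk (maximalIdeal O ^ n) (b g) = χ₁ g - χ₂ g) ∧
      IsSplit ϖ σ n fun g => algebraMap O K (b g) := by
  rw [isConjugatePair_iff] at h
  choose s d hs hd hs' hd' using h
  have hb (g : G) := Ideal.Quotient.mk_surjective
    (χ₁ g - χ₂ g : O ⧸ maximalIdeal O ^ n)
  choose b hb using hb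
  refine ⟨b, hb, fun g => OrdGE.of_int _, fun g h => ?_⟩
  have e : disc σ g h - algebraMap O K (b g) * algebraMap O K (b h) =
      algebraMap O K (2 * s (g * h) - s g * s h - b g * b h) := by
    simp only [disc, map_sub, map_mul, hs, map_ofNat]
  rw [e, ← mk_eq_zero_iff hϖ]
  simp only [map_sub, map_mul, hs', hb, Units.val_mul, map_ofNat]
  ring

/-- The pair of equal characters given by half of the trace. -/
theorem exists_isConjugatePair_self (hϖ : Irreducible ϖ) (hchar : ringChar (ResidueField O) ≠ 2)
    (hs : ∀ g, OrdGE ϖ 0 (σ g : Matrix (Fin 2) (Fin 2) K).trace)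
    (hd : ∀ g, OrdGE ϖ 0 (σ g : Matrix (Fin 2) (Fin 2) K).det)
    (hdisc : ∀ g h, OrdGE ϖ n (disc σ g h)) :
    ∃ χ : Character O G n, IsConjugatePair σ χ χ := by
  simp only [ordGE_zero_iff] at hs hd
  choose s hs using hs
  choose d hd using hd
  obtain ⟨i, hi⟩ : ∃ i : O, 2 * i = 1 := by
    obtain ⟨u, hu⟩ := ordEq_two (ϖ := ϖ) (K := K) hchar
    refine ⟨((u⁻¹ : Oˣ) : O), ?_⟩
    have : (2 : O) = u := IsFractionRing.injective O K (by simpa [map_ofNat] using hu)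
    rw [this, Units.mul_inv]
  have hi' := congrArg (Ideal.Quotient.mk (maximalIdeal O ^ n)) hi
  rw [map_mul, map_one, map_ofNat] at hi'
  -- Vanishing of `disc` modulo `ϖ ^ n` says precisely that half of the trace is multiplicative.
  have hmul (g h : G) : Ideal.Quotient.mk (maximalIdeal O ^ n) (2 * s (g * h) - s g * s h) = 0 := by
    rw [mk_eq_zero_iff (K := K) hϖ]
    convert hdisc g h using 1
    simp only [disc, map_sub, map_mul, hs, map_ofNat]
  have hdet (g : G) : 4 * d g = s g * s g - (2 * s (g * g) - s g * s g) := by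
    apply IsFractionRing.injective O K
    simp only [map_sub, map_mul, hs, hd, map_ofNat]
    simp only [det_fin_two, GeneralLinearGroup.coe_mul, trace_fin_two, mul_apply,
      Fin.sum_univ_two]
    ring
  have hs1 : s 1 = 2 := IsFractionRing.injective O K (by simp [hs, map_ofNat])
  let f : G →* (O ⧸ maximalIdeal O ^ n) :=
    { toFun := fun g => Ideal.Quotient.mk (maximalIdeal O ^ n) (i * s g)
      map_one' := by
        rw [hs1, mul_comm, hi, map_one]
      map_mul' := fun g h => by
        have := hmul g h
        simp only [map_sub, map_mul, map_ofNat] at this ⊢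
        generalize Ideal.Quotient.mk (maximalIdeal O ^ n) i = j at *
        linear_combination j * j * this - j * Ideal.Quotient.mk _ (s (g * h)) * hi' }
  refine ⟨f.toHomUnits, isConjugatePair_iff.2 fun g => ⟨s g, d g, hs g, hd g, ?_, ?_⟩⟩
  · simp only [MonoidHom.coe_toHomUnits, f, MonoidHom.coe_mk, OneHom.coe_mk, map_mul]
    linear_combination -Ideal.Quotient.mk _ (s g) * hi'
  · have h1 := congrArg (Ideal.Quotient.mk (maximalIdeal O ^ n)) (hdet g)
    rw [map_sub, hmul g g] at h1
    simp only [MonoidHom.coe_toHomUnits, f, MonoidHom.coe_mk, OneHom.coe_mk, map_mul,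
      map_ofNat] at h1 ⊢
    linear_combination Ideal.Quotient.mk _ i * Ideal.Quotient.mk _ i * h1 -
      (2 * Ideal.Quotient.mk _ i + 1) * Ideal.Quotient.mk _ (d g) * hi'

/-- The pair of characters given by the diagonal entries of matrices which are upper triangular
modulo `ϖ ^ n`. -/
theorem Level.exists_isConjugatePair (hϖ : Irreducible ϖ)
    (hchar : ringChar (ResidueField O) ≠ 2)
    (hs : ∀ g, OrdGE ϖ 0 (σ g : Matrix (Fin 2) (Fin 2) K).trace) (h : Level ϖ σ 0 0 n) :
    ∃ χ₁ χ₂ : Character O G n, IsConjugatePair σ χ₁ χ₂ := by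
  have h2 : OrdEq ϖ 0 (2 : K) := ordEq_two hchar
  have hα (g : G) : OrdGE ϖ 0 (σ g 0 0) := by
    refine OrdGE.of_mul_left (k := 0) hϖ h2 ?_ (by omega)
    have := (hs g).add (h g).1
    rw [trace_fin_two, diff] at this
    convert this using 1
    ring
  have hδ (g : G) : OrdGE ϖ 0 (σ g 1 1) := by
    refine OrdGE.of_mul_left (k := 0) hϖ h2 ?_ (by omega)
    have := (hs g).sub (h g).1
    rw [trace_fin_two, diff] at this
    convert this using 1
    ring
  have hβ (g : G) : OrdGE ϖ 0 (σ g 0 1) := (h g).2.1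
  have hγ (g : G) : OrdGE ϖ 0 (σ g 1 0) := (h g).2.2.mono hϖ (by omega)
  simp only [ordGE_zero_iff] at hα hδ hβ hγ
  choose α hα using hα
  choose δ hδ using hδ
  choose β hβ using hβ
  choose γ hγ using hγ
  have hγ0 (g : G) : Ideal.Quotient.mk (maximalIdeal O ^ n) (γ g) = 0 := by
    rw [mk_eq_zero_iff (K := K) hϖ, hγ]
    exact (h g).2.2
  have hone : α 1 = 1 ∧ δ 1 = 1 := by
    constructor <;> apply IsFractionRing.injective O K <;> simp [hα, hδ]
  have hαm (g h : G) : α (g * h) = α g * α h + β g * γ h := by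
    apply IsFractionRing.injective O K
    simp only [map_add, map_mul, hα, hβ, hγ, GeneralLinearGroup.coe_mul, mul_apply,
      Fin.sum_univ_two]
  have hδm (g h : G) : δ (g * h) = γ g * β h + δ g * δ h := by
    apply IsFractionRing.injective O K
    simp only [map_add, map_mul, hδ, hβ, hγ, GeneralLinearGroup.coe_mul, mul_apply,
      Fin.sum_univ_two]
  let f₁ : G →* (O ⧸ maximalIdeal O ^ n) :=
    { toFun := fun g => Ideal.Quotient.mk (maximalIdeal O ^ n) (α g)
      map_one' := by rw [hone.1, map_one]
      map_mul' := fun g h => by rw [hαm, map_add, map_mul, map_mul, hγ0, mul_zero, add_zero] }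
  let f₂ : G →* (O ⧸ maximalIdeal O ^ n) :=
    { toFun := fun g => Ideal.Quotient.mk (maximalIdeal O ^ n) (δ g)
      map_one' := by rw [hone.2, map_one]
      map_mul' := fun g h => by rw [hδm, map_add, map_mul, map_mul, hγ0, zero_mul, zero_add] }
  refine ⟨f₁.toHomUnits, f₂.toHomUnits, isConjugatePair_iff.2 fun g =>
    ⟨α g + δ g, α g * δ g - β g * γ g, ?_, ?_, ?_, ?_⟩⟩
  · rw [map_add, hα, hδ, trace_fin_two]
  · rw [map_sub, map_mul, map_mul, hα, hβ, hγ, hδ, det_fin_two]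
  · simp [f₁, f₂]
  · simp [f₁, f₂, hγ0]

theorem congruenceDepth_eq (hϖ : Irreducible ϖ) {χ₁ χ₂ : Character O G n} {b : G → O}
    (hb : ∀ g, Ideal.Quotient.mk (maximalIdeal O ^ n) (b g) = χ₁ g - χ₂ g) {m : ℕ} (hm : m ≤ n)
    (h : ∀ g, OrdGE ϖ m (algebraMap O K (b g)))
    (hmax : ∀ m' ≤ n, (∀ g, OrdGE ϖ m' (algebraMap O K (b g))) → m' ≤ m) :
    congruenceDepth χ₁ χ₂ = m := by
  have key (m' : ℕ) (hm' : m' ≤ n) (g : G) :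
      (χ₁ g : O ⧸ maximalIdeal O ^ n) - (χ₂ g : O ⧸ maximalIdeal O ^ n) ∈
        (maximalIdeal O ^ m').map (Ideal.Quotient.mk (maximalIdeal O ^ n)) ↔
      OrdGE ϖ m' (algebraMap O K (b g)) := by
    rw [← hb, Ideal.mem_quotient_iff_mem (Ideal.pow_le_pow_right hm'),
      mem_maximalIdeal_pow_iff (K := K) hϖ]
  apply IsGreatest.csSup_eq
  exact ⟨⟨hm, fun g => (key m hm g).2 (h g)⟩, fun m' hm' =>
    hmax m' hm'.1 fun g => (key m' hm'.1 g).1 (hm'.2 g)⟩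

theorem congruenceDepth_le (χ₁ χ₂ : Character O G n) : congruenceDepth χ₁ χ₂ ≤ n :=
  csSup_le' fun _ hm => hm.1

theorem congruenceDepth_self (χ : Character O G n) : congruenceDepth χ χ = n :=
  IsGreatest.csSup_eq ⟨⟨le_rfl, fun g => by simp⟩, fun _ hm => hm.1⟩

theorem indexN_eq (hmem : ∃ χ₁ χ₂ : Character O G n, IsConjugatePair σ χ₁ χ₂)
    (hmax : ∀ (m : ℕ) (χ₁ χ₂ : Character O G m), IsConjugatePair σ χ₁ χ₂ → m ≤ n) :
    indexN O σ = n := by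
  apply le_antisymm
  · refine iSup₂_le fun m hm => ?_
    obtain ⟨χ₁, χ₂, h⟩ := hm
    exact_mod_cast hmax m χ₁ χ₂ h
  · exact le_iSup₂_of_le n hmem le_rfl

theorem indexM_eq {m : ℕ} (hn : indexN O σ = n)
    (hmem : ∃ χ₁ χ₂ : Character O G n, IsConjugatePair σ χ₁ χ₂ ∧ congruenceDepth χ₁ χ₂ = m)
    (hmax : ∀ χ₁ χ₂ : Character O G n, IsConjugatePair σ χ₁ χ₂ → congruenceDepth χ₁ χ₂ ≤ m) :
    indexM O σ = m := by
  have hn' : (indexN O σ).toNat = n := by rw [hn, ENat.toNat_natCast]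
  unfold indexM
  rw [hn']
  apply IsGreatest.csSup_eq
  refine ⟨hmem, ?_⟩
  rintro _ ⟨χ₁, χ₂, h, rfl⟩
  exact hmax χ₁ χ₂ h

/-- The error `2 (β γ' + γ β')` has order `c + (c + l)`. Large levels thus give precise splittings,
which irreducibility bounds. -/
theorem Level.isSplit (hϖ : Irreducible ϖ) {c l : ℤ} (hc : 0 ≤ c) (h : Level ϖ σ c c (c + l)) :
    IsSplit ϖ σ (2 * c + l) (diff σ) := by
  refine ⟨fun g => (h g).1.mono hϖ hc, fun g h' => ?_⟩
  have e : disc σ g h' - diff σ g * diff σ h' = 2 * (σ g 0 1 * σ h' 1 0 + σ g 1 0 * σ h' 0 1) := by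
    rw [disc_eq]
    ring
  rw [e]
  exact OrdGE.two.mul_of_eq hϖ (((h g).2.1.mul_of_eq hϖ (h h').2.2 (k := 2 * c + l) (by ring)).add
    ((h g).2.2.mul_of_eq hϖ (h h').2.1 (by ring))) (by ring)

/-- `P` is a frame at an end of a nerve of length `l`, for a band of radius `c`. -/
structure IsExtremal (ϖ : O) (σ : G →* GL (Fin 2) K) (P : GL (Fin 2) K) (c l : ℕ) : Prop where
  level : Level ϖ (conjRep σ P) c c (c + l)
  not_level_succ : ∀ P', ¬ Level ϖ (conjRep σ P') (c + 1) (c + 1) (c + 1)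
  not_level_length : ∀ P', ¬ Level ϖ (conjRep σ P') c c (c + l + 1)

theorem exists_isExtremal [IsAdicComplete (maximalIdeal O) O] (hϖ : Irreducible ϖ)
    (hchar : ringChar (ResidueField O) ≠ 2) (hirr : NoStableLine σ)
    (h : ∃ P, Level ϖ (conjRep σ P) 0 0 0) : ∃ P c l, IsExtremal ϖ σ P c l := by
  have hfin := not_forall_isSplit (ϖ := ϖ) hϖ hchar hirr
  have hsplit {P : GL (Fin 2) K} {c l : ℕ} (h : Level ϖ (conjRep σ P) c c (c + l)) :
      ∃ n ≥ 2 * c + l, ∃ B : G → K, IsSplit ϖ σ n B := by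
    refine ⟨2 * c + l, le_rfl, diff (conjRep σ P), ?_⟩
    have := h.isSplit hϖ (by omega)
    simpa only [IsSplit, disc_conjRep, Nat.cast_add, Nat.cast_mul, Nat.cast_ofNat] using this
  obtain ⟨c, ⟨P, hP⟩, hc⟩ : ∃ c : ℕ, (∃ P, Level ϖ (conjRep σ P) c c c) ∧
      ∀ P', ¬ Level ϖ (conjRep σ P') (c + 1) (c + 1) (c + 1) := by
    by_contra! H
    have hall (c : ℕ) : ∃ P, Level ϖ (conjRep σ P) c c c := by
      induction c with
      | zero => exact_mod_cast h
      | succ c ih => exact_mod_cast H c ih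
    refine hfin fun N => ?_
    obtain ⟨P, hP⟩ := hall N
    obtain ⟨n, hn, B, hB⟩ := hsplit (l := 0) (by simpa using hP)
    exact ⟨n, by omega, B, hB⟩
  obtain ⟨l, ⟨P', hP'⟩, hl⟩ : ∃ l : ℕ, (∃ P, Level ϖ (conjRep σ P) c c (c + l)) ∧
      ∀ P', ¬ Level ϖ (conjRep σ P') c c (c + l + 1) := by
    by_contra! H
    have hall (l : ℕ) : ∃ P, Level ϖ (conjRep σ P) c c (c + l) := by
      induction l with
      | zero => exact ⟨P, by simpa using hP⟩
      | succ l ih =>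
        obtain ⟨P, hP⟩ := H l ih
        exact ⟨P, by simpa [add_assoc] using hP⟩
    refine hfin fun N => ?_
    obtain ⟨P, hP⟩ := hall N
    obtain ⟨n, hn, B, hB⟩ := hsplit hP
    exact ⟨n, by omega, B, hB⟩
  exact ⟨P', c, l, hP', hc, hl⟩

variable {P : GL (Fin 2) K} {c l : ℕ}

theorem IsExtremal.le_of_isConjugatePair [IsAdicComplete (maximalIdeal O) O]
    (hE : IsExtremal ϖ σ P c l) (hϖ : Irreducible ϖ)
    (hchar : ringChar (ResidueField O) ≠ 2) (hirr : NoStableLine σ)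
    {χ₁ χ₂ : Character O G n} (h : IsConjugatePair σ χ₁ χ₂) : n ≤ 2 * c + l := by
  obtain ⟨b, -, hb⟩ := h.exists_isSplit hϖ
  have := (hb.conj P).le_of_extremal hϖ hchar (hirr.conj P) (c := c) (l := l) (by omega)
    (hE.level.mono hϖ le_rfl le_rfl (by omega))
    (fun P' => by simpa only [conjRep_mul] using hE.not_level_succ (P * P'))
    (fun P' => by simpa only [conjRep_mul] using hE.not_level_length (P * P'))
  omega

/-- Along this apartment, position `i` has level `c` for `0 ≤ i ≤ l` and is fixed for `-c ≤ i ≤ c +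
l`. -/
theorem IsExtremal.level_shift (hE : IsExtremal ϖ σ P c l) (hϖ : Irreducible ϖ) (i : ℤ) :
    Level ϖ (conjRep σ (P * shift hϖ i)) c (c + i) (c + l - i) := by
  rw [conjRep_mul]
  exact hE.level.conj_shift hϖ i rfl rfl

theorem IsExtremal.indexN_eq [IsAdicComplete (maximalIdeal O) O]
    (hE : IsExtremal ϖ σ P c l) (hϖ : Irreducible ϖ)
    (hchar : ringChar (ResidueField O) ≠ 2) (hirr : NoStableLine σ)
    (hs : ∀ g, OrdGE ϖ 0 (σ g : Matrix (Fin 2) (Fin 2) K).trace) :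
    indexN O σ = (2 * c + l : ℕ) := by
  refine BTTree.indexN_eq ?_ fun m χ₁ χ₂ h => hE.le_of_isConjugatePair hϖ hchar hirr h
  -- Position `-c` is the end of the fixed part of the apartment, where all off-diagonal
  -- divisibility sits in the lower left entry.
  have h1 : Level ϖ (conjRep σ (P * shift hϖ (-c))) 0 0 ((2 * c + l : ℕ) : ℤ) :=
    (hE.level_shift hϖ (-c)).mono hϖ (by omega) (by omega) (by push_cast; omega)
  obtain ⟨χ₁, χ₂, h⟩ := h1.exists_isConjugatePair hϖ hchar (by simpa only [trace_conjRep] using hs)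
  exact ⟨χ₁, χ₂, isConjugatePair_conjRep.1 h⟩

/-- The dichotomy is whether some `disc g g` has exact order `2c` while `l ≥ 1`. If so, `(χ₁ - χ₂)²`
has that order at `g`, so every pair has depth `c`. If not, `disc` vanishes modulo `ϖ ^ (2c + l)`
and the half-trace pair has the largest possible depth. Both alternatives allow `l = 1`. -/
theorem IsExtremal.indexM_eq [IsAdicComplete (maximalIdeal O) O]
    (hE : IsExtremal ϖ σ P c l) (hϖ : Irreducible ϖ)
    (hchar : ringChar (ResidueField O) ≠ 2) (hirr : NoStableLine σ)
    (hs : ∀ g, OrdGE ϖ 0 (σ g : Matrix (Fin 2) (Fin 2) K).trace)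
    (hd : ∀ g, OrdGE ϖ 0 (σ g : Matrix (Fin 2) (Fin 2) K).det) :
    (1 ≤ l ∧ indexM O σ = c) ∨ (l ≤ 1 ∧ indexM O σ = 2 * c + l) := by
  have hN := hE.indexN_eq hϖ hchar hirr hs
  have hQ (g h : G) : OrdGE ϖ (2 * c) (disc σ g h) := by
    have hL := hE.level
    rw [← disc_conjRep σ P, disc_eq]
    exact ((hL g).1.mul_of_eq hϖ (hL h).1 (by ring)).add (OrdGE.two.mul_of_eq hϖ
      (((hL g).2.1.mul_of_le hϖ (hL h).2.2 (k := 2 * c) (by omega)).add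
        ((hL g).2.2.mul_of_le hϖ (hL h).2.1 (by omega))) (by ring))
  by_cases hU : 1 ≤ l ∧ ∃ g, ¬ OrdGE ϖ (2 * c + 1) (disc σ g g)
  · obtain ⟨hl, g, hg⟩ := hU
    refine Or.inl ⟨hl, ?_⟩
    have hdepth (χ₁ χ₂ : Character O G (2 * c + l)) (h : IsConjugatePair σ χ₁ χ₂) :
        congruenceDepth χ₁ χ₂ = c := by
      obtain ⟨b, hb, hB⟩ := h.exists_isSplit hϖ
      obtain ⟨j, hj, hjB⟩ := hB.ordEq_of_disc hϖ (ordEq_of_not_succ hϖ (hQ g g) hg)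
        (by push_cast; omega)
      obtain rfl : (c : ℤ) = j := by omega
      refine congruenceDepth_eq (K := K) hϖ hb (by omega) (fun i => ?_) fun m _ hm => ?_
      · refine OrdGE.of_sq (k := 2 * c) hϖ ?_ (by omega)
        have e : algebraMap O K (b i) * algebraMap O K (b i) = disc σ i i -
            (disc σ i i - algebraMap O K (b i) * algebraMap O K (b i)) := by ring
        rw [e]
        exact (hQ i i).sub ((hB.2 i i).mono hϖ (by push_cast; omega))
      · exact_mod_cast (ordGE_zpow_mul_unit_iff hϖ hjB).1 (hm g)
    refine BTTree.indexM_eq hN ?_ fun χ₁ χ₂ h => (hdepth χ₁ χ₂ h).le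
    have h1 : Level ϖ (conjRep σ (P * shift hϖ (-c))) 0 0 ((2 * c + l : ℕ) : ℤ) :=
      (hE.level_shift hϖ (-c)).mono hϖ (by omega) (by omega) (by push_cast; omega)
    obtain ⟨χ₁, χ₂, h⟩ :=
      h1.exists_isConjugatePair hϖ hchar (by simpa only [trace_conjRep] using hs)
    rw [isConjugatePair_conjRep] at h
    exact ⟨χ₁, χ₂, h, hdepth χ₁ χ₂ h⟩
  · push Not at hU
    have hx (hl : 1 ≤ l) (g : G) : OrdGE ϖ (c + 1) (diff (conjRep σ P) g) := by
      have hL := hE.level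
      refine OrdGE.of_sq (k := 2 * c + 1) hϖ ?_ (by omega)
      have e : diff (conjRep σ P) g * diff (conjRep σ P) g =
          disc σ g g - 2 * (2 * (conjRep σ P g 0 1 * conjRep σ P g 1 0)) := by
        rw [← disc_conjRep σ P, disc_eq]
        ring
      rw [e]
      exact (hU hl g).sub (OrdGE.two.mul_of_eq hϖ (OrdGE.two.mul hϖ
        ((hL g).2.1.mul_of_le hϖ (hL g).2.2 (k := 2 * c + 1) (by omega))) (by ring))
    -- For `l ≥ 2`, position 1 would have both off-diagonal orders at least `c + 1`, and `hx`
    -- supplies the diagonal one, against the maximality of `c`.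
    have hl1 : l ≤ 1 := by
      by_contra! hl
      refine hE.not_level_succ (P * shift hϖ 1) fun g => ?_
      obtain ⟨-, h2, h3⟩ := hE.level_shift hϖ 1 g
      refine ⟨?_, h2, h3.mono hϖ (by omega)⟩
      rw [conjRep_mul, shift, diff_conjRep_dg]
      exact hx (by omega) g
    refine Or.inr ⟨hl1, ?_⟩
    have hQ' (g h : G) : OrdGE ϖ ((2 * c + l : ℕ) : ℤ) (disc σ g h) := by
      rcases Nat.eq_zero_or_pos l with rfl | hl
      · simpa using hQ g h
      have hL := hE.level
      rw [← disc_conjRep σ P, disc_eq]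
      exact ((hx hl g).mul_of_le hϖ (hx hl h) (by push_cast; omega)).add (OrdGE.two.mul_of_eq hϖ
        (((hL g).2.1.mul_of_le hϖ (hL h).2.2 (k := (2 * c + l : ℕ)) (by push_cast; omega)).add
          ((hL g).2.2.mul_of_le hϖ (hL h).2.1 (by push_cast; omega))) (by ring))
    obtain ⟨χ, hχ⟩ := exists_isConjugatePair_self hϖ hchar hs hd hQ'
    exact BTTree.indexM_eq hN ⟨χ, χ, hχ, congruenceDepth_self χ⟩
      fun χ₁ χ₂ _ => congruenceDepth_le χ₁ χ₂

end Characters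

/-! ### Lattices as frames modulo integral changes, and the Cartan decomposition -/

section Frames

set_option linter.unusedSectionVars false

variable {O K G : Type*} [CommRing O] [IsDomain O] [IsDiscreteValuationRing O]
  [Field K] [Algebra O K] [IsFractionRing O K] [Group G] {ϖ : O}

variable (O) in
/-- The linear combinations with coefficients in `O` of the columns of `P`. -/
noncomputable def frameSubmodule (P : GL (Fin 2) K) : Submodule O (Fin 2 → K) :=
  LinearMap.range (((toLin' (P : Matrix (Fin 2) (Fin 2) K)).restrictScalars O).comp
    ((Algebra.linearMap O K).compLeft (Fin 2)))

theorem mem_frameSubmodule_iff {P : GL (Fin 2) K} {v : Fin 2 → K} :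
    v ∈ frameSubmodule O P ↔
      ∃ w : Fin 2 → O, (P : Matrix (Fin 2) (Fin 2) K) *ᵥ (fun i => algebraMap O K (w i)) = v :=
  Iff.rfl

theorem inv_mulVec_mulVec (P : GL (Fin 2) K) (v : Fin 2 → K) :
    ((P⁻¹ : GL (Fin 2) K) : Matrix (Fin 2) (Fin 2) K) *ᵥ
      ((P : Matrix (Fin 2) (Fin 2) K) *ᵥ v) = v := by
  rw [mulVec_mulVec, ← GeneralLinearGroup.coe_mul, inv_mul_cancel, GeneralLinearGroup.coe_one,
    one_mulVec]

theorem mulVec_inv_mulVec (P : GL (Fin 2) K) (v : Fin 2 → K) :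
    (P : Matrix (Fin 2) (Fin 2) K) *ᵥ
      (((P⁻¹ : GL (Fin 2) K) : Matrix (Fin 2) (Fin 2) K) *ᵥ v) = v := by
  rw [mulVec_mulVec, ← GeneralLinearGroup.coe_mul, mul_inv_cancel, GeneralLinearGroup.coe_one,
    one_mulVec]

theorem mem_frameSubmodule {P : GL (Fin 2) K} {v : Fin 2 → K} (ϖ : O) :
    v ∈ frameSubmodule O P ↔
      ∀ i, OrdGE ϖ 0 ((((P⁻¹ : GL (Fin 2) K) : Matrix (Fin 2) (Fin 2) K) *ᵥ v) i) := by
  simp only [ordGE_zero_iff]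
  constructor
  · rintro ⟨w, rfl⟩ i
    refine ⟨w i, ?_⟩
    change _ = (((P⁻¹ : GL (Fin 2) K) : Matrix (Fin 2) (Fin 2) K) *ᵥ
      ((P : Matrix (Fin 2) (Fin 2) K) *ᵥ (fun i => algebraMap O K (w i)))) i
    rw [inv_mulVec_mulVec]
  · intro h
    choose w hw using h
    refine mem_frameSubmodule_iff.2 ⟨w, ?_⟩
    simp only [hw]
    exact mulVec_inv_mulVec P v

theorem frameSubmodule_isLattice (P : GL (Fin 2) K) :
    Submodule.IsLattice K (frameSubmodule O P) where
  fg := by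
    rw [frameSubmodule, LinearMap.range_eq_map]
    exact Submodule.FG.map _ Module.Finite.fg_top
  span_eq_top := by
    rw [eq_top_iff]
    intro v _
    rw [← mulVec_inv_mulVec P v]
    generalize ((P⁻¹ : GL (Fin 2) K) : Matrix (Fin 2) (Fin 2) K) *ᵥ v = u
    have hu : u = ∑ i, u i • (Pi.single i 1 : Fin 2 → K) := by
      ext j
      simp [Finset.sum_apply, Pi.single_apply]
    rw [hu, mulVec_sum]
    refine sum_mem fun i _ => ?_
    rw [mulVec_smul]
    refine Submodule.smul_mem _ _ (Submodule.subset_span ?_)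
    refine mem_frameSubmodule_iff.2 ⟨Pi.single i 1, ?_⟩
    congr 1
    ext j
    rcases eq_or_ne j i with rfl | hj <;> simp [*]

variable (O) in
/-- The lattice spanned by the columns of `P`. -/
noncomputable def frameLattice (P : GL (Fin 2) K) : Lattice O K :=
  ⟨frameSubmodule O P, frameSubmodule_isLattice P⟩

theorem exists_frameLattice_eq (L : Lattice O K) : ∃ P, frameLattice O P = L := by
  obtain ⟨L, hL⟩ := L
  have hr : Module.finrank O L = 2 := by
    simpa using Submodule.IsLattice.finrank_of_pi K L
  let b : Module.Basis (Fin 2) O L := Module.finBasisOfFinrankEq O L hr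
  let bK := b.extendOfIsLattice K
  let M : Matrix (Fin 2) (Fin 2) K := (Pi.basisFun K (Fin 2)).toMatrix bK
  have hM : M.det ≠ 0 := by
    rw [← Module.Basis.det_apply]
    exact ((Pi.basisFun K (Fin 2)).isUnit_det bK).ne_zero
  refine ⟨GeneralLinearGroup.mkOfDetNeZero M hM, Subtype.ext ?_⟩
  have hmul (w : Fin 2 → O) : M *ᵥ (fun i => algebraMap O K (w i)) = (b.equivFun.symm w : L) := by
    rw [Module.Basis.equivFun_symm_apply]
    ext i
    simp [M, bK, mulVec, dotProduct, Module.Basis.toMatrix_apply, Algebra.smul_def, mul_comm]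
  ext v
  change v ∈ frameSubmodule O _ ↔ _
  rw [mem_frameSubmodule_iff]
  constructor
  · rintro ⟨w, rfl⟩
    change M *ᵥ _ ∈ L
    rw [hmul]
    exact Subtype.prop _
  · intro hv
    refine ⟨b.equivFun ⟨v, hv⟩, ?_⟩
    change M *ᵥ _ = v
    rw [hmul, LinearEquiv.symm_apply_apply]

theorem frameLattice_le_iff (ϖ : O) {P Q : GL (Fin 2) K} :
    (frameLattice O Q).1 ≤ (frameLattice O P).1 ↔
      ∀ i j, OrdGE ϖ 0 ((P⁻¹ * Q : GL (Fin 2) K) i j) := by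
  have hcol (j : Fin 2) (N : GL (Fin 2) K) (i : Fin 2) :
      ((N : Matrix (Fin 2) (Fin 2) K) *ᵥ Pi.single j 1) i = N i j := by simp
  constructor
  · intro h i j
    have h1 : (Q : Matrix (Fin 2) (Fin 2) K) *ᵥ Pi.single j 1 ∈ (frameLattice O Q).1 := by
      refine (mem_frameSubmodule ϖ).2 fun i => ?_
      rw [inv_mulVec_mulVec]
      rcases eq_or_ne i j with rfl | hj <;> simp [OrdGE.one, OrdGE.zero, *]
    have h2 := (mem_frameSubmodule ϖ).1 (h h1) i
    rwa [mulVec_mulVec, ← GeneralLinearGroup.coe_mul, hcol] at h2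
  · intro h v hv
    refine (mem_frameSubmodule ϖ).2 fun i => ?_
    rw [← mulVec_inv_mulVec Q v, mulVec_mulVec, ← GeneralLinearGroup.coe_mul]
    have hv' := (mem_frameSubmodule ϖ).1 hv
    generalize (((Q⁻¹ : GL (Fin 2) K) : Matrix (Fin 2) (Fin 2) K) *ᵥ v) = u at hv' ⊢
    simp only [mulVec, dotProduct, Fin.sum_univ_two]
    have m (j : Fin 2) : OrdGE ϖ 0 ((P⁻¹ * Q : GL (Fin 2) K) i j * u j) := by
      obtain ⟨a, ha⟩ := ordGE_zero_iff.1 (h i j)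
      obtain ⟨b, hb⟩ := ordGE_zero_iff.1 (hv' j)
      exact ordGE_zero_iff.2 ⟨a * b, by rw [map_mul, ha, hb]⟩
    exact (m 0).add (m 1)

theorem mulVec_mem_frameLattice_iff (ϖ : O) {P N : GL (Fin 2) K} :
    (∀ v ∈ (frameLattice O P).1, (N : Matrix (Fin 2) (Fin 2) K) *ᵥ v ∈ (frameLattice O P).1) ↔
      ∀ i j, OrdGE ϖ 0 ((P⁻¹ * N * P : GL (Fin 2) K) i j) := by
  rw [mul_assoc, ← frameLattice_le_iff]
  constructor
  · rintro h _ ⟨w, rfl⟩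
    have := h _ (mem_frameSubmodule_iff.2 ⟨w, rfl⟩)
    rwa [mulVec_mulVec, ← GeneralLinearGroup.coe_mul] at this
  · rintro h v ⟨w, rfl⟩
    refine h (mem_frameSubmodule_iff.2 ⟨w, ?_⟩)
    rw [GeneralLinearGroup.coe_mul, ← mulVec_mulVec]
    rfl

theorem scalar_mulVec (c : Kˣ) (v : Fin 2 → K) :
    ((GeneralLinearGroup.scalar (Fin 2) c : GL (Fin 2) K) : Matrix (Fin 2) (Fin 2) K) *ᵥ v =
      c • v := by
  rw [GeneralLinearGroup.coe_scalar]
  ext i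
  simp [Units.smul_def]

theorem scale_frameLattice (c : Kˣ) (P : GL (Fin 2) K) :
    (frameLattice O P).scale c = frameLattice O (GeneralLinearGroup.scalar (Fin 2) c * P) := by
  apply Subtype.ext
  ext v
  change v ∈ c • frameSubmodule O P ↔ v ∈ frameSubmodule O _
  refine (Submodule.mem_smul_pointwise_iff_exists v c _).trans ?_
  simp only [mem_frameSubmodule_iff, GeneralLinearGroup.coe_mul, ← mulVec_mulVec, scalar_mulVec]
  constructor
  · rintro ⟨_, ⟨w, rfl⟩, rfl⟩
    exact ⟨w, rfl⟩
  · rintro ⟨w, rfl⟩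
    exact ⟨_, ⟨w, rfl⟩, rfl⟩

theorem coe_inv_mul_scalar_mul (c : Kˣ) (P Q : GL (Fin 2) K) (i j : Fin 2) :
    (P⁻¹ * (GeneralLinearGroup.scalar (Fin 2) c * Q) : GL (Fin 2) K) i j =
      c * (P⁻¹ * Q : GL (Fin 2) K) i j := by
  rw [← mul_assoc, ← GeneralLinearGroup.scalar_commute, mul_assoc,
    GeneralLinearGroup.coe_mul (GeneralLinearGroup.scalar _ _), GeneralLinearGroup.coe_scalar]
  simp

theorem IsIntegralFrame.mul (hϖ : Irreducible ϖ) {k k' : GL (Fin 2) K}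
    (hk : IsIntegralFrame ϖ k) (hk' : IsIntegralFrame ϖ k') : IsIntegralFrame ϖ (k * k') := by
  constructor
  · intro i j
    rw [GeneralLinearGroup.coe_mul, mul_apply, Fin.sum_univ_two]
    exact ((hk.1 ..).mul_of_eq hϖ (hk'.1 ..) (by ring)).add
      ((hk.1 ..).mul_of_eq hϖ (hk'.1 ..) (by ring))
  · have := hk.2.mul hϖ hk'.2
    rw [← det_fin_two, ← det_fin_two, ← det_mul, ← GeneralLinearGroup.coe_mul, det_fin_two] at this
    simpa using this

theorem isIntegralFrame_swap : IsIntegralFrame ϖ (swap : GL (Fin 2) K) := by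
  constructor
  · intro i j
    fin_cases i <;> fin_cases j <;> simp [coe_swap, OrdGE.one, OrdGE.zero]
  · simpa [coe_swap] using (OrdEq.one (ϖ := ϖ) (K := K)).neg

theorem IsIntegralFrame.inv (hϖ : Irreducible ϖ) {k : GL (Fin 2) K}
    (hk : IsIntegralFrame ϖ k) (i j : Fin 2) : OrdGE ϖ 0 ((k⁻¹ : GL (Fin 2) K) i j) := by
  rw [GeneralLinearGroup.coe_inv, inv_entries, Matrix.smul_apply, smul_eq_mul]
  refine hk.2.inv.ordGE.mul_of_eq hϖ (n := 0) ?_ (by simp)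
  fin_cases i <;> fin_cases j <;> simp [hk.1, (hk.1 0 1).neg, (hk.1 1 0).neg]

theorem isIntegralFrame_of_integral (hϖ : Irreducible ϖ) {k : GL (Fin 2) K}
    (hk : ∀ i j, OrdGE ϖ 0 (k i j)) (hk' : ∀ i j, OrdGE ϖ 0 ((k⁻¹ : GL (Fin 2) K) i j)) :
    IsIntegralFrame ϖ k := by
  refine ⟨hk, ?_⟩
  have hdet {k : GL (Fin 2) K} (hk : ∀ i j, OrdGE ϖ 0 (k i j)) :
      OrdGE ϖ 0 (k : Matrix (Fin 2) (Fin 2) K).det := by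
    rw [det_fin_two]
    exact ((hk ..).mul_of_eq hϖ (hk ..) (by ring)).sub ((hk ..).mul_of_eq hϖ (hk ..) (by ring))
  have h1 : (k : Matrix (Fin 2) (Fin 2) K).det *
      ((k⁻¹ : GL (Fin 2) K) : Matrix (Fin 2) (Fin 2) K).det = 1 := by
    rw [← det_mul, ← GeneralLinearGroup.coe_mul, mul_inv_cancel, GeneralLinearGroup.coe_one,
      det_one]
  rw [← det_fin_two]
  refine ordEq_of_not_succ hϖ (hdet hk) fun h => ?_
  have := h.mul hϖ (hdet hk')
  rw [h1] at this
  exact (OrdEq.one (K := K)).not_succ hϖ (by simpa using this)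

theorem frameLattice_mul (hϖ : Irreducible ϖ) (P : GL (Fin 2) K) {k : GL (Fin 2) K}
    (hk : IsIntegralFrame ϖ k) : frameLattice O (P * k) = frameLattice O P := by
  apply Subtype.ext
  apply le_antisymm
  · rw [frameLattice_le_iff ϖ]
    simpa using hk.1
  · rw [frameLattice_le_iff ϖ]
    simpa using hk.inv hϖ

variable (O) in
/-- The vertex of the tree given by a frame. -/
noncomputable def vertex (P : GL (Fin 2) K) : Vertex O K := (frameLattice O P).cls

theorem exists_vertex_eq (x : Vertex O K) : ∃ P, vertex O P = x := by
  induction x using Quotient.inductionOn with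
  | h L =>
    obtain ⟨P, rfl⟩ := exists_frameLattice_eq L
    exact ⟨P, rfl⟩

theorem vertex_mul (hϖ : Irreducible ϖ) (P : GL (Fin 2) K) {k : GL (Fin 2) K}
    (hk : IsIntegralFrame ϖ k) : vertex O (P * k) = vertex O P := by
  rw [vertex, frameLattice_mul hϖ P hk, vertex]

theorem vertex_scalar_mul (c : Kˣ) (P : GL (Fin 2) K) :
    vertex O (GeneralLinearGroup.scalar (Fin 2) c * P) = vertex O P := by
  rw [vertex, ← scale_frameLattice, Lattice.cls_scale, vertex]

theorem exists_of_vertex_eq (hϖ : Irreducible ϖ) {P Q : GL (Fin 2) K}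
    (h : vertex O P = vertex O Q) : ∃ (c : Kˣ) (k : GL (Fin 2) K), IsIntegralFrame ϖ k ∧
      Q = GeneralLinearGroup.scalar (Fin 2) c * P * k := by
  obtain ⟨c, hc⟩ := (Quotient.exact h : ∃ c : Kˣ, frameLattice O Q = (frameLattice O P).scale c)
  rw [scale_frameLattice] at hc
  refine ⟨c, (GeneralLinearGroup.scalar (Fin 2) c * P)⁻¹ * Q, ?_, by group⟩
  refine isIntegralFrame_of_integral hϖ ((frameLattice_le_iff ϖ).1 (by rw [hc])) ?_
  have := (frameLattice_le_iff ϖ (P := Q)).1 (by rw [hc] :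
    (frameLattice O (GeneralLinearGroup.scalar (Fin 2) c * P)).1 ≤ _)
  simpa using this

theorem conjRep_scalar_mul (σ : G →* GL (Fin 2) K) (c : Kˣ) (P : GL (Fin 2) K) :
    conjRep σ (GeneralLinearGroup.scalar (Fin 2) c * P) = conjRep σ P := by
  ext1 g
  rw [conjRep_apply, conjRep_apply, _root_.mul_inv_rev, mul_assoc, mul_assoc,
    GeneralLinearGroup.scalar_commute, ← mul_assoc (σ g), ← GeneralLinearGroup.scalar_commute,
    inv_mul_cancel_left, mul_assoc]

/-- Two frames of a vertex differ by a scalar, which conjugation ignores, and an integral frame; so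
the level `(n, n, n)` belongs to the vertex. -/
theorem Level.of_vertex_eq (hϖ : Irreducible ϖ) {σ : G →* GL (Fin 2) K} {n : ℤ}
    {P Q : GL (Fin 2) K} (h : Level ϖ (conjRep σ P) n n n) (hPQ : vertex O P = vertex O Q) :
    Level ϖ (conjRep σ Q) n n n := by
  obtain ⟨c, k, hk, rfl⟩ := exists_of_vertex_eq hϖ hPQ
  rw [conjRep_mul, conjRep_scalar_mul]
  exact h.of_isIntegralFrame hϖ hk

/-- Gaussian elimination with a pivot of least order keeps all multipliers integral. The exponent
`e` is the order of `det H / (H 0 0)²`, whose unit part goes into `k'`. -/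
theorem cartan_of_corner (hϖ : Irreducible ϖ) {H : GL (Fin 2) K} {n : ℤ}
    (h : ∀ i j, OrdGE ϖ n (H i j)) (h00 : OrdEq ϖ n (H 0 0)) :
    ∃ (c : Kˣ) (k k' : GL (Fin 2) K) (e : ℕ), IsIntegralFrame ϖ k ∧ IsIntegralFrame ϖ k' ∧
      H = GeneralLinearGroup.scalar (Fin 2) c * (k * shift hϖ e * k') := by
  have h0 := h00.ne_zero hϖ
  have hD0 : H 0 0 * H 1 1 - H 0 1 * H 1 0 ≠ 0 := det_ne_zero H
  have hD : OrdGE ϖ (2 * n) (H 0 0 * H 1 1 - H 0 1 * H 1 0) :=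
    ((h ..).mul_of_eq hϖ (h ..) (by ring)).sub ((h ..).mul_of_eq hϖ (h ..) (by ring))
  obtain ⟨m, hm⟩ := exists_ordEq hϖ hD0
  have hmn := (ordGE_zpow_mul_unit_iff hϖ hm).1 hD
  obtain ⟨e, rfl⟩ := Int.le.dest hmn
  have hd := hm.mul hϖ (h00.inv.mul hϖ h00.inv)
  obtain ⟨u, hu⟩ := hd
  have hq {x : K} (hx : OrdGE ϖ n x) : OrdGE ϖ 0 (x * (H 0 0)⁻¹) :=
    hx.mul_of_eq hϖ h00.inv.ordGE (by ring)
  have hu0 : algebraMap O K u ≠ 0 := algebraMap_unit_ne_zero u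
  refine ⟨Units.mk0 _ h0, gl 1 0 (H 1 0 * (H 0 0)⁻¹) 1 (by simp),
    gl 1 (H 0 1 * (H 0 0)⁻¹) 0 (algebraMap O K u) (by simp), e, ⟨?_, ?_⟩, ⟨?_, ?_⟩, ?_⟩
  · intro i j
    fin_cases i <;> fin_cases j <;> simp [OrdGE.one, OrdGE.zero, hq (h 1 0)]
  · simp [OrdEq.one]
  · intro i j
    fin_cases i <;> fin_cases j <;> simp [OrdGE.one, OrdGE.zero, hq (h 0 1), OrdGE.of_int]
  · simpa using OrdEq.unit u
  · have hu' : algebraMap O K ϖ ^ (e : ℤ) * algebraMap O K u =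
        (H 0 0 * H 1 1 - H 0 1 * H 1 0) * ((H 0 0)⁻¹ * (H 0 0)⁻¹) := by
      rw [hu]
      congr 2
      ring
    have e1 : H 0 0 * ((H 1 0) * (H 0 0)⁻¹ * (H 0 1 * (H 0 0)⁻¹) +
        algebraMap O K ϖ ^ (e : ℤ) * algebraMap O K u) = H 1 1 := by
      rw [hu']
      field_simp
      ring
    apply Units.ext
    simp only [GeneralLinearGroup.coe_mul, GeneralLinearGroup.coe_scalar, coe_gl, coe_shift,
      Units.val_mk0]
    ext i j
    fin_cases i <;> fin_cases j
    · simp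
    · simp [h0, mul_comm]
    · simp [h0, mul_comm]
    · simpa using e1.symm

theorem swap_mul_swap : (swap * swap : GL (Fin 2) K) = 1 := by
  apply Units.ext
  rw [GeneralLinearGroup.coe_mul, coe_swap]
  simp [one_fin_two]

/-- The Cartan decomposition of `GL_2(K)`. -/
theorem cartan (hϖ : Irreducible ϖ) (H : GL (Fin 2) K) :
    ∃ (c : Kˣ) (k k' : GL (Fin 2) K) (e : ℕ), IsIntegralFrame ϖ k ∧ IsIntegralFrame ϖ k' ∧
      H = GeneralLinearGroup.scalar (Fin 2) c * (k * shift hϖ e * k') := by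
  have hbdd : ∃ b : ℤ, ∀ n : ℤ, (∀ i j, OrdGE ϖ n (H i j)) → n ≤ b := by
    by_contra! hcon
    have hzero (i j : Fin 2) : H i j = 0 := by
      by_contra h0
      obtain ⟨m, hm⟩ := exists_ordEq hϖ h0
      obtain ⟨n, hn, hmn⟩ := hcon m
      have := (ordGE_zpow_mul_unit_iff hϖ hm).1 (hn i j)
      omega
    apply det_ne_zero H
    simp [hzero]
  have hex (x : K) : ∃ n : ℤ, OrdGE ϖ n x := by
    by_cases h0 : x = 0
    · exact ⟨0, h0 ▸ .zero⟩
    · obtain ⟨m, hm⟩ := exists_ordEq hϖ h0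
      exact ⟨m, hm.ordGE⟩
  have hne : ∃ n : ℤ, ∀ i j, OrdGE ϖ n (H i j) := by
    choose f hf using hex
    refine ⟨min (min (f (H 0 0)) (f (H 0 1))) (min (f (H 1 0)) (f (H 1 1))), fun i j => ?_⟩
    refine (hf (H i j)).mono hϖ ?_
    fin_cases i <;> fin_cases j <;> simp
  -- The greatest common order `n` is attained by some entry, which swaps of rows and columns then
  -- bring to the corner.
  obtain ⟨n, hn, hmax⟩ := Int.exists_greatest_of_bdd hbdd hne
  obtain ⟨i, j, hij⟩ : ∃ i j, ¬ OrdGE ϖ (n + 1) (H i j) := by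
    by_contra! hcon
    have := hmax _ hcon
    omega
  replace hij := ordEq_of_not_succ hϖ (hn i j) hij
  have hl (A : GL (Fin 2) K) (i j : Fin 2) : (swap * A : GL (Fin 2) K) i j = A (1 - i) j := by
    rw [GeneralLinearGroup.coe_mul, coe_swap, mul_apply, Fin.sum_univ_two]
    fin_cases i <;> simp
  have hr (A : GL (Fin 2) K) (i j : Fin 2) : (A * swap : GL (Fin 2) K) i j = A i (1 - j) := by
    rw [GeneralLinearGroup.coe_mul, coe_swap, mul_apply, Fin.sum_univ_two]
    fin_cases j <;> simp
  have hsw := isIntegralFrame_swap (ϖ := ϖ) (K := K)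
  have left {A : GL (Fin 2) K} (h : ∃ (c : Kˣ) (k k' : GL (Fin 2) K) (e : ℕ),
      IsIntegralFrame ϖ k ∧ IsIntegralFrame ϖ k' ∧
      swap * A = GeneralLinearGroup.scalar (Fin 2) c * (k * shift hϖ e * k')) :
      ∃ (c : Kˣ) (k k' : GL (Fin 2) K) (e : ℕ), IsIntegralFrame ϖ k ∧ IsIntegralFrame ϖ k' ∧
        A = GeneralLinearGroup.scalar (Fin 2) c * (k * shift hϖ e * k') := by
    obtain ⟨c, k, k', e, hk, hk', hA⟩ := h
    refine ⟨c, swap * k, k', e, hsw.mul hϖ hk, hk', ?_⟩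
    have : A = swap * (swap * A) := by rw [← mul_assoc, swap_mul_swap, one_mul]
    rw [this, hA, ← mul_assoc, ← GeneralLinearGroup.scalar_commute]
    simp only [mul_assoc]
  have right {A : GL (Fin 2) K} (h : ∃ (c : Kˣ) (k k' : GL (Fin 2) K) (e : ℕ),
      IsIntegralFrame ϖ k ∧ IsIntegralFrame ϖ k' ∧
      A * swap = GeneralLinearGroup.scalar (Fin 2) c * (k * shift hϖ e * k')) :
      ∃ (c : Kˣ) (k k' : GL (Fin 2) K) (e : ℕ), IsIntegralFrame ϖ k ∧ IsIntegralFrame ϖ k' ∧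
        A = GeneralLinearGroup.scalar (Fin 2) c * (k * shift hϖ e * k') := by
    obtain ⟨c, k, k', e, hk, hk', hA⟩ := h
    refine ⟨c, k, k' * swap, e, hk, hk'.mul hϖ hsw, ?_⟩
    have : A = A * swap * swap := by rw [mul_assoc, swap_mul_swap, mul_one]
    rw [this, hA]
    simp only [mul_assoc]
  fin_cases i <;> fin_cases j
  · exact cartan_of_corner hϖ hn hij
  · exact right (cartan_of_corner hϖ (n := n) (fun i j => by rw [hr]; exact hn ..)
      (by rw [hr]; exact hij))
  · exact left (cartan_of_corner hϖ (n := n) (fun i j => by rw [hl]; exact hn ..)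
      (by rw [hl]; exact hij))
  · exact left (right (cartan_of_corner hϖ (n := n) (fun i j => by rw [hr, hl]; exact hn ..)
      (by rw [hr, hl]; exact hij)))

/-- Two vertices lie in a common apartment, with a frame of the first one. -/
theorem exists_vertex_shift (hϖ : Irreducible ϖ) (P Q : GL (Fin 2) K) :
    ∃ (k : GL (Fin 2) K) (e : ℕ), IsIntegralFrame ϖ k ∧
      vertex O (P * k * shift hϖ e) = vertex O Q := by
  obtain ⟨c, k, k', e, hk, hk', h⟩ := cartan hϖ (P⁻¹ * Q)
  refine ⟨k, e, hk, ?_⟩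
  have hQ : Q = GeneralLinearGroup.scalar (Fin 2) c * (P * k * shift hϖ e * k') := by
    rw [← mul_inv_cancel_left P Q, h, ← mul_assoc, ← GeneralLinearGroup.scalar_commute]
    simp only [mul_assoc]
  rw [hQ, vertex_scalar_mul, vertex_mul hϖ _ hk']

end Frames

/-! ### Distances in the tree -/

section Distance

set_option linter.unusedSectionVars false

variable {O K : Type*} [CommRing O] [IsDomain O] [IsDiscreteValuationRing O]
  [Field K] [Algebra O K] [IsFractionRing O K] {ϖ : O}

theorem exists_walk_of_chain {V : Type*} (H : SimpleGraph V) (f : ℕ → V) (n : ℕ)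
    (h : ∀ i < n, H.Adj (f i) (f (i + 1))) :
    ∃ p : H.Walk (f 0) (f n), p.length = n ∧ ∀ z, z ∈ p.support ↔ ∃ i ≤ n, f i = z := by
  induction n with
  | zero => exact ⟨.nil, rfl, fun z => by simp [eq_comm]⟩
  | succ n ih =>
    obtain ⟨p, hp, hs⟩ := ih fun i hi => h i (by omega)
    refine ⟨p.concat (h n (by omega)), by simp [hp], fun z => ?_⟩
    rw [SimpleGraph.Walk.support_concat, List.mem_append, hs]
    constructor
    · rintro (⟨i, hi, rfl⟩ | hz)
      · exact ⟨i, by omega, rfl⟩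
      · exact ⟨n + 1, le_rfl, by simpa [eq_comm] using hz⟩
    · rintro ⟨i, hi, rfl⟩
      rcases Nat.lt_or_ge n i with hin | hin
      · obtain rfl : i = n + 1 := by omega
        simp
      · exact Or.inl ⟨i, hin, rfl⟩

/-- The uniformizer as a unit of the fraction field. -/
noncomputable def unif (K : Type*) [Field K] [Algebra O K] [IsFractionRing O K]
    (hϖ : Irreducible ϖ) : Kˣ :=
  Units.mk0 (algebraMap O K ϖ) (algebraMap_uniformizer_ne_zero hϖ)

theorem ordEq_unif (hϖ : Irreducible ϖ) : OrdEq ϖ 1 (unif K hϖ : K) :=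
  ⟨1, by simp [unif]⟩

theorem maximalIdeal_smul_frameLattice (hϖ : Irreducible ϖ) (P : GL (Fin 2) K) :
    maximalIdeal O • (frameLattice O P).1 =
      (frameLattice O (GeneralLinearGroup.scalar (Fin 2) (unif K hϖ) * P)).1 := by
  rw [← scale_frameLattice]
  exact maximalIdeal_smul_eq hϖ _ rfl _

theorem not_ordGE_zpow_neg_one (hϖ : Irreducible ϖ) :
    ¬ OrdGE ϖ 0 (algebraMap O K ϖ ^ (-1 : ℤ)) := by
  rw [ordGE_zpow_mul_unit_iff hϖ (OrdEq.zpow (-1))]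
  omega

theorem adj_shift (hϖ : Irreducible ϖ) (P : GL (Fin 2) K) :
    (tree O K).Adj (vertex O P) (vertex O (P * shift hϖ 1)) := by
  have hinv : (shift hϖ 1 : GL (Fin 2) K)⁻¹ = shift hϖ (-1) := by
    rw [inv_eq_iff_mul_eq_one, ← shift_add]
    exact shift_zero hϖ
  have hϖ0 := algebraMap_uniformizer_ne_zero (K := K) hϖ
  refine ⟨_, _, rfl, rfl, ?_, ?_⟩
  · rw [maximalIdeal_smul_frameLattice hϖ]
    refine lt_of_le_not_ge ?_ fun h => ?_
    · rw [frameLattice_le_iff ϖ]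
      intro i j
      rw [coe_inv_mul_scalar_mul, _root_.mul_inv_rev, mul_assoc, inv_mul_cancel, mul_one, hinv,
        coe_shift]
      fin_cases i <;> fin_cases j <;>
        simp [unif, OrdGE.zero, OrdGE.of_int, OrdGE.one, hϖ0]
    · rw [frameLattice_le_iff ϖ] at h
      have := h 0 0
      rw [_root_.mul_inv_rev, mul_assoc, ← map_inv, GeneralLinearGroup.scalar_commute,
        mul_assoc, ← GeneralLinearGroup.scalar_commute, inv_mul_cancel_left,
        GeneralLinearGroup.coe_mul, GeneralLinearGroup.coe_scalar] at this
      apply not_ordGE_zpow_neg_one (K := K) hϖ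
      simpa [unif, coe_shift] using this
  · refine lt_of_le_not_ge ?_ fun h => ?_
    · rw [frameLattice_le_iff ϖ]
      intro i j
      rw [inv_mul_cancel_left, coe_shift]
      fin_cases i <;> fin_cases j <;> simp [OrdGE.zero, OrdGE.of_int, OrdGE.one]
    · rw [frameLattice_le_iff ϖ] at h
      have := h 1 1
      rw [_root_.mul_inv_rev, mul_assoc, inv_mul_cancel, mul_one, hinv, coe_shift] at this
      apply not_ordGE_zpow_neg_one (K := K) hϖ
      simpa using this

theorem exists_lattice_of_adj (hϖ : Irreducible ϖ) (L : Lattice O K) {y : Vertex O K}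
    (h : (tree O K).Adj L.cls y) :
    ∃ M : Lattice O K, M.cls = y ∧ M.1 ≤ L.1 ∧ ∀ v ∈ L.1, ϖ • v ∈ M.1 := by
  obtain ⟨L₁, M₁, hL, rfl, h1, h2⟩ := h
  obtain ⟨c, rfl⟩ := (Quotient.exact hL : ∃ c : Kˣ, L = L₁.scale c)
  refine ⟨M₁.scale c, Lattice.cls_scale c M₁, units_smul_mono c h2.le, ?_⟩
  intro v hv
  obtain ⟨w, hw, rfl⟩ := (Submodule.mem_smul_pointwise_iff_exists v c _).1 hv
  rw [smul_comm]
  refine Submodule.smul_mem_pointwise_smul _ c M₁.1 (h1.le ?_)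
  refine Submodule.smul_mem_smul ?_ hw
  rw [hϖ.maximalIdeal_eq]
  exact Ideal.mem_span_singleton_self ϖ

theorem exists_lattice_of_walk (hϖ : Irreducible ϖ) {x y : Vertex O K}
    (p : (tree O K).Walk x y) (L : Lattice O K) (hL : L.cls = x) :
    ∃ M : Lattice O K, M.cls = y ∧ M.1 ≤ L.1 ∧ ∀ v ∈ L.1, ϖ ^ p.length • v ∈ M.1 := by
  induction p generalizing L with
  | nil => exact ⟨L, hL, le_rfl, fun v hv => by simpa using hv⟩
  | cons h p ih =>
    subst hL
    obtain ⟨M, hM, hML, hLM⟩ := exists_lattice_of_adj hϖ L h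
    obtain ⟨N, hN, hNM, hMN⟩ := ih M hM
    refine ⟨N, hN, hNM.trans hML, fun v hv => ?_⟩
    rw [SimpleGraph.Walk.length_cons, pow_succ, mul_smul]
    exact hMN _ (hLM v hv)

/-- A walk of length `d` from the class of `L` ends at some `M` with `ϖ ^ d L ≤ M ≤ L`. If `M` is
`c` times the end lattice, the second inclusion makes `c` integral and the first makes `ϖ ^ (d - e)
/ c` integral; multiplying eliminates `c`. Acyclicity of the graph is not needed. -/
theorem le_length_of_walk (hϖ : Irreducible ϖ) {P : GL (Fin 2) K} {e : ℕ}
    (p : (tree O K).Walk (vertex O P) (vertex O (P * shift hϖ e))) : e ≤ p.length := by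
  obtain ⟨M, hM, hMP, hPM⟩ := exists_lattice_of_walk hϖ p (frameLattice O P) rfl
  obtain ⟨c, rfl⟩ := (Quotient.exact hM.symm :
    ∃ c : Kˣ, M = (frameLattice O (P * shift hϖ e)).scale c)
  rw [scale_frameLattice] at hMP hPM
  rw [frameLattice_le_iff ϖ] at hMP
  have hc := hMP 0 0
  rw [coe_inv_mul_scalar_mul, inv_mul_cancel_left, coe_shift] at hc
  have hle : (frameLattice O (GeneralLinearGroup.scalar (Fin 2) (unif K hϖ ^ p.length) * P)).1 ≤
      (frameLattice O (GeneralLinearGroup.scalar (Fin 2) c * (P * shift hϖ e))).1 := by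
    rw [← scale_frameLattice]
    intro v hv
    obtain ⟨w, hw, rfl⟩ := (Submodule.mem_smul_pointwise_iff_exists v _ _).1 hv
    convert hPM w hw using 1
    ext i
    simp [unif, Units.smul_def, Algebra.smul_def]
  rw [frameLattice_le_iff ϖ] at hle
  have h1 := hle 1 1
  have hinv : (shift hϖ e : GL (Fin 2) K)⁻¹ = shift hϖ (-e) := by
    rw [inv_eq_iff_mul_eq_one, ← shift_add, add_neg_cancel]
    exact shift_zero hϖ
  rw [coe_inv_mul_scalar_mul, _root_.mul_inv_rev, ← map_inv, ← GeneralLinearGroup.scalar_commute,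
    mul_assoc, GeneralLinearGroup.coe_mul, GeneralLinearGroup.coe_scalar, _root_.mul_inv_rev,
    mul_assoc, inv_mul_cancel, mul_one, hinv, coe_shift] at h1
  simp only [scalar_apply, diagonal_mul, of_apply, cons_val', cons_val_one, cons_val_fin_one]
    at h1
  have h2 : OrdGE ϖ 0 ((c : K) * (((unif K hϖ ^ p.length : Kˣ) : K) *
      ((c⁻¹ : Kˣ) * algebraMap O K ϖ ^ (-(e : ℤ))))) :=
    OrdGE.mul_of_eq hϖ (by simpa using hc) h1 (by ring)
  have h3 : (c : K) * (((unif K hϖ ^ p.length : Kˣ) : K) *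
      ((c⁻¹ : Kˣ) * algebraMap O K ϖ ^ (-(e : ℤ)))) =
      algebraMap O K ϖ ^ ((p.length : ℤ) + -(e : ℤ)) := by
    rw [zpow_add₀ (algebraMap_uniformizer_ne_zero hϖ), zpow_natCast]
    have := c.ne_zero
    simp only [Units.val_inv_eq_inv_val, Units.val_pow_eq_pow_val]
    field_simp
    simp [unif, mul_comm]
  rw [h3, ordGE_zpow_mul_unit_iff hϖ (OrdEq.zpow _)] at h2
  omega

theorem adj_shift_succ (hϖ : Irreducible ϖ) (P : GL (Fin 2) K) (i : ℕ) :
    (tree O K).Adj (vertex O (P * shift hϖ i)) (vertex O (P * shift hϖ (i + 1 : ℕ))) := by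
  have := adj_shift hϖ (P * shift hϖ i)
  rwa [mul_assoc, ← shift_add] at this

theorem exists_walk_shift (hϖ : Irreducible ϖ) (P : GL (Fin 2) K) (n : ℕ) :
    ∃ p : (tree O K).Walk (vertex O P) (vertex O (P * shift hϖ n)), p.length = n ∧
      ∀ z, z ∈ p.support ↔ ∃ i : ℕ, i ≤ n ∧ vertex O (P * shift hϖ i) = z := by
  obtain ⟨p, hp, hs⟩ := exists_walk_of_chain (tree O K) (fun i => vertex O (P * shift hϖ i)) n
    fun i _ => adj_shift_succ hϖ P i
  have h0 : vertex O (P * shift hϖ (0 : ℕ)) = vertex O P := by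
    rw [Nat.cast_zero, shift_zero, mul_one]
  refine ⟨p.copy h0 rfl, by simpa using hp, fun z => ?_⟩
  rw [SimpleGraph.Walk.support_copy]
  exact hs z

theorem edist_shift (hϖ : Irreducible ϖ) (P : GL (Fin 2) K) (e : ℕ) :
    (tree O K).edist (vertex O P) (vertex O (P * shift hϖ e)) = e := by
  obtain ⟨p, hp, -⟩ := exists_walk_shift hϖ P e
  apply le_antisymm
  · exact_mod_cast hp ▸ SimpleGraph.edist_le p
  · refine le_iInf fun q => ?_
    exact_mod_cast le_length_of_walk hϖ q

theorem isSegment_shift (hϖ : Irreducible ϖ) (P : GL (Fin 2) K) (n : ℕ) :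
    IsSegment {z : Vertex O K | ∃ i : ℕ, i ≤ n ∧ vertex O (P * shift hϖ i) = z} := by
  obtain ⟨p, hp, hs⟩ := exists_walk_shift (O := O) hϖ P n
  refine ⟨_, _, p, p.isPath_of_length_eq_dist ?_, ?_⟩
  · rw [hp, SimpleGraph.dist, edist_shift hϖ, ENat.toNat_natCast]
  · ext z
    exact (hs z).symm

/-- Two vertices, with the distance between them, in a common apartment. -/
theorem exists_frame_of_edist (hϖ : Irreducible ϖ) (P : GL (Fin 2) K) (y : Vertex O K) :
    ∃ (k : GL (Fin 2) K) (e : ℕ), IsIntegralFrame ϖ k ∧ vertex O (P * k * shift hϖ e) = y ∧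
      (tree O K).edist (vertex O P) y = e := by
  obtain ⟨Q, rfl⟩ := exists_vertex_eq y
  obtain ⟨k, e, hk, h⟩ := exists_vertex_shift (O := O) hϖ P Q
  refine ⟨k, e, hk, h, ?_⟩
  rw [← h, ← vertex_mul hϖ P hk, edist_shift]

end Distance

/-! ### Branches at a vertex -/

section Branches

set_option linter.unusedSectionVars false

variable {O K : Type*} [CommRing O] [IsDomain O] [IsDiscreteValuationRing O]
  [Field K] [Algebra O K] [IsFractionRing O K] {ϖ : O}

/-- The relative position `H` of a lattice which is contained in the sum of the line of the first
basis vector and of the multiples of `ϖ`, but not in the multiples of `ϖ`. -/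
def IsBranchMatrix (ϖ : O) (H : GL (Fin 2) K) : Prop :=
  (∀ j, OrdGE ϖ 0 (H 0 j) ∧ OrdGE ϖ 1 (H 1 j)) ∧ ∃ j, ¬ OrdGE ϖ 1 (H 0 j)

theorem IsBranchMatrix.mul (hϖ : Irreducible ϖ) {H k : GL (Fin 2) K}
    (h : IsBranchMatrix ϖ H) (hk : IsIntegralFrame ϖ k) : IsBranchMatrix ϖ (H * k) := by
  refine ⟨fun j => ⟨?_, ?_⟩, ?_⟩
  · rw [GeneralLinearGroup.coe_mul, mul_apply, Fin.sum_univ_two]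
    exact ((h.1 _).1.mul_of_eq hϖ (hk.1 ..) (by ring)).add
      ((h.1 _).1.mul_of_eq hϖ (hk.1 ..) (by ring))
  · rw [GeneralLinearGroup.coe_mul, mul_apply, Fin.sum_univ_two]
    exact ((h.1 _).2.mul_of_eq hϖ (hk.1 ..) (by ring)).add
      ((h.1 _).2.mul_of_eq hϖ (hk.1 ..) (by ring))
  · by_contra! hcon
    obtain ⟨j, hj⟩ := h.2
    apply hj
    have : H 0 j = (H * k * k⁻¹ : GL (Fin 2) K) 0 j := by rw [mul_inv_cancel_right]
    rw [this, GeneralLinearGroup.coe_mul, mul_apply, Fin.sum_univ_two]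
    exact ((hcon _).mul_of_eq hϖ (hk.inv hϖ ..) (by ring)).add
      ((hcon _).mul_of_eq hϖ (hk.inv hϖ ..) (by ring))

/-- `y` lies in the branch at the vertex `P` in the direction of the first basis vector. -/
def InBranch (ϖ : O) (P : GL (Fin 2) K) (y : Vertex O K) : Prop :=
  ∃ Q, vertex O Q = y ∧ IsBranchMatrix ϖ (P⁻¹ * Q)

theorem inBranch_shift (hϖ : Irreducible ϖ) (P : GL (Fin 2) K) {e : ℤ} (he : 1 ≤ e) :
    InBranch ϖ P (vertex O (P * shift hϖ e)) := by
  refine ⟨_, rfl, ?_⟩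
  rw [inv_mul_cancel_left, IsBranchMatrix, coe_shift]
  refine ⟨fun j => ?_, 0, ?_⟩
  · fin_cases j
    · simp [OrdGE.one, OrdGE.zero]
    · simpa [OrdGE.zero] using (OrdGE.zpow e).mono hϖ he
  · simpa using (OrdEq.one (ϖ := ϖ) (K := K)).not_succ hϖ

/-- A branch can be left only through its root. In a suitable frame of `y`, the neighbour `z`
multiplies the second column of the relative position `H` by `ϖ`; what remains depends on whether
the first column of `H` is divisible by `ϖ`. -/
theorem InBranch.of_adj (hϖ : Irreducible ϖ) {P : GL (Fin 2) K} {y z : Vertex O K}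
    (h : InBranch ϖ P y) (hyz : (tree O K).Adj y z) (hz : z ≠ vertex O P) : InBranch ϖ P z := by
  obtain ⟨Q₀, rfl, hQ₀⟩ := h
  obtain ⟨k, e, hk, rfl, he⟩ := exists_frame_of_edist hϖ Q₀ z
  rw [SimpleGraph.edist_eq_one_iff_adj.2 hyz] at he
  obtain rfl : e = 1 := by exact_mod_cast he.symm
  rw [Nat.cast_one] at hz ⊢
  have hQ : IsBranchMatrix ϖ (P⁻¹ * (Q₀ * k)) := by
    rw [← mul_assoc]
    exact hQ₀.mul hϖ hk
  generalize Q₀ * k = Q at hQ hz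
  set H := P⁻¹ * Q with hH
  have hϖ0 := algebraMap_uniformizer_ne_zero (K := K) hϖ
  by_cases h00 : OrdGE ϖ 1 (H 0 0)
  · have h01 : OrdEq ϖ 0 (H 0 1) := by
      obtain ⟨j, hj⟩ := hQ.2
      fin_cases j
      · exact absurd h00 hj
      · exact ordEq_of_not_succ hϖ (hQ.1 1).1 (by simpa using hj)
    -- Up to homothety, the step divides the first column by `ϖ` and keeps the second. Either the
    -- result is again a branch matrix, or its determinant is a unit and `z` is the root.
    set Q' := GeneralLinearGroup.scalar (Fin 2) (unif K hϖ)⁻¹ * (Q * shift hϖ 1) with hQ'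
    have hvQ' : vertex O Q' = vertex O (Q * shift hϖ 1) := vertex_scalar_mul _ _
    have hent (i j : Fin 2) : (P⁻¹ * Q' : GL (Fin 2) K) i j =
        (algebraMap O K ϖ)⁻¹ * (H * shift hϖ 1 : GL (Fin 2) K) i j := by
      rw [hQ', coe_inv_mul_scalar_mul, hH, mul_assoc P⁻¹]
      simp [unif]
    have hl (i : Fin 2) : (P⁻¹ * Q' : GL (Fin 2) K) i 0 = (algebraMap O K ϖ)⁻¹ * H i 0 := by
      rw [hent, GeneralLinearGroup.coe_mul, coe_shift, mul_apply, Fin.sum_univ_two]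
      simp
    have hr (i : Fin 2) : (P⁻¹ * Q' : GL (Fin 2) K) i 1 = H i 1 := by
      rw [hent, GeneralLinearGroup.coe_mul, coe_shift, mul_apply, Fin.sum_univ_two]
      simp
      field_simp
    have hinv : OrdGE ϖ (-1) (algebraMap O K ϖ)⁻¹ := (ordEq_unif hϖ).inv.ordGE
    have h00' : OrdGE ϖ 0 ((P⁻¹ * Q' : GL (Fin 2) K) 0 0) := by
      rw [hl]
      exact hinv.mul_of_eq hϖ h00 (by ring)
    have h10' : OrdGE ϖ 0 ((P⁻¹ * Q' : GL (Fin 2) K) 1 0) := by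
      rw [hl]
      exact hinv.mul_of_eq hϖ (hQ.1 0).2 (by ring)
    have h01' : OrdEq ϖ 0 ((P⁻¹ * Q' : GL (Fin 2) K) 0 1) := by rwa [hr]
    have h11' : OrdGE ϖ 1 ((P⁻¹ * Q' : GL (Fin 2) K) 1 1) := by
      rw [hr]
      exact (hQ.1 1).2
    by_cases h10 : OrdGE ϖ 1 ((P⁻¹ * Q' : GL (Fin 2) K) 1 0)
    · refine ⟨Q', hvQ', fun j => ?_, 1, by simpa using h01'.not_succ hϖ⟩
      fin_cases j
      · exact ⟨h00', h10⟩
      · exact ⟨h01'.ordGE, h11'⟩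
    · exfalso
      apply hz
      have h10u : OrdEq ϖ 0 ((P⁻¹ * Q' : GL (Fin 2) K) 1 0) :=
        ordEq_of_not_succ hϖ h10' (by simpa using h10)
      have hfr : IsIntegralFrame ϖ (P⁻¹ * Q') := by
        refine ⟨fun i j => ?_, ?_⟩
        · fin_cases i <;> fin_cases j
          exacts [h00', h01'.ordGE, h10', h11'.mono hϖ (by omega)]
        · have hmul := (h01'.mul hϖ h10u).neg
          have hpi : OrdGE ϖ 1 ((P⁻¹ * Q' : GL (Fin 2) K) 0 0 * (P⁻¹ * Q' : GL (Fin 2) K) 1 1) :=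
            h00'.mul_of_eq hϖ h11' (by ring)
          rw [sub_eq_add_neg]
          refine ordEq_of_not_succ hϖ ((hpi.mono hϖ (by omega)).add
            (by simpa using hmul.ordGE)) fun hcon => ?_
          rw [zero_add, hpi.add_iff_right] at hcon
          exact hmul.not_succ hϖ (by simpa using hcon)
      rw [← hvQ', ← vertex_mul hϖ P hfr, mul_inv_cancel_left]
  · refine ⟨_, rfl, ?_⟩
    rw [← mul_assoc, ← hH]
    have hl (i : Fin 2) : (H * shift hϖ 1 : GL (Fin 2) K) i 0 = H i 0 := by
      rw [GeneralLinearGroup.coe_mul, coe_shift, mul_apply, Fin.sum_univ_two]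
      simp
    have hr (i : Fin 2) : (H * shift hϖ 1 : GL (Fin 2) K) i 1 = H i 1 * algebraMap O K ϖ := by
      rw [GeneralLinearGroup.coe_mul, coe_shift, mul_apply, Fin.sum_univ_two]
      simp
    refine ⟨fun j => ?_, 0, by simpa only [hl] using h00⟩
    fin_cases j
    · simp only [Fin.zero_eta, hl]
      exact hQ.1 0
    · simp only [Fin.mk_one, hr]
      exact ⟨(hQ.1 1).1.mul_of_eq hϖ (OrdGE.of_int ϖ) (by ring),
        (hQ.1 1).2.mul_of_eq hϖ (OrdGE.of_int ϖ) (by ring)⟩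

theorem InBranch.getVert (hϖ : Irreducible ϖ) {P : GL (Fin 2) K} {x y : Vertex O K}
    (p : (tree O K).Walk x y) {a b : ℕ} (hab : a ≤ b) (hb : b ≤ p.length)
    (h : InBranch ϖ P (p.getVert a)) (hne : ∀ i, a ≤ i → i ≤ b → p.getVert i ≠ vertex O P) :
    InBranch ϖ P (p.getVert b) := by
  induction b, hab using Nat.le_induction with
  | base => exact h
  | succ b hab ih =>
    exact (ih (by omega) fun i hi hib => hne i hi (by omega)).of_adj hϖ
      (p.adj_getVert_succ (by omega)) (hne _ (by omega) le_rfl)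

/-- Branches in different directions are disjoint. -/
theorem InBranch.disjoint (hϖ : Irreducible ϖ) {P k : GL (Fin 2) K} {y : Vertex O K}
    (hk : IsIntegralFrame ϖ k) (h10 : OrdEq ϖ 0 (k 1 0)) (h : InBranch ϖ P y)
    (h' : InBranch ϖ (P * k) y) : False := by
  obtain ⟨Q, rfl, hQ⟩ := h
  obtain ⟨Q', hQQ', hQ'⟩ := h'
  obtain ⟨s, k', hk', rfl⟩ := exists_of_vertex_eq hϖ hQQ'.symm
  have hN := hQ.mul hϖ hk'
  set N := P⁻¹ * Q * k'
  set H := (P * k)⁻¹ * (GeneralLinearGroup.scalar (Fin 2) s * Q * k') with hH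
  have hkH : k * H = GeneralLinearGroup.scalar (Fin 2) s * N := by
    rw [hH, _root_.mul_inv_rev]
    simp only [mul_assoc, mul_inv_cancel_left, N]
    rw [← mul_assoc, ← GeneralLinearGroup.scalar_commute, mul_assoc]
  clear_value H N
  have hent (i j : Fin 2) : k i 0 * H 0 j + k i 1 * H 1 j = s * N i j := by
    have h1 : (k * H : GL (Fin 2) K) i j = s * N i j := by
      rw [hkH, GeneralLinearGroup.coe_mul, GeneralLinearGroup.coe_scalar]
      simp
    rw [← h1, GeneralLinearGroup.coe_mul, mul_apply, Fin.sum_univ_two]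
  obtain ⟨m, hm⟩ := exists_ordEq hϖ s.ne_zero
  obtain ⟨j, hj⟩ := hQ'.2
  obtain ⟨i, hi⟩ := hN.2
  -- If the scalar `s` were integral, the second row of `k H = s N` and the unit `k 1 0` would make
  -- the first row of `H` divisible by `ϖ`. So `s` has a pole, and the integrality of `k H` then
  -- makes the first row of `N` divisible by `ϖ`.
  have hm0 : m < 0 := by
    by_contra! hm0
    apply hj
    refine OrdGE.of_mul_left (k := 1) hϖ h10 ?_ (by omega)
    have e := hent 1 j
    have : k 1 0 * H 0 j = s * N 1 j - k 1 1 * H 1 j := by rw [← e]; ring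
    rw [this]
    exact (hm.ordGE.mul_of_le hϖ (hN.1 j).2 (by omega)).sub
      ((hk.1 1 1).mul_of_eq hϖ (hQ'.1 j).2 (by ring))
  apply hi
  refine OrdGE.of_mul_left (k := 0) hϖ hm ?_ (by omega)
  rw [← hent]
  exact ((hk.1 ..).mul_of_eq hϖ (hQ'.1 i).1 (by ring)).add
    ((hk.1 ..).mul_of_le hϖ (hQ'.1 i).2 (by omega))

end Branches

/-! ### The fixed vertices: nerve, radius and diameter -/

section Nerve

set_option linter.unusedSectionVars false

variable {O K G : Type*} [CommRing O] [IsDomain O] [IsDiscreteValuationRing O]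
  [Field K] [Algebra O K] [IsFractionRing O K] [Group G] {ϖ : O}
  {σ : G →* GL (Fin 2) K} {P : GL (Fin 2) K} {c l : ℕ}

theorem level_of_integral (h : ∀ g i j, OrdGE ϖ 0 (σ g i j)) : Level ϖ σ 0 0 0 := fun g =>
  ⟨(h g 0 0).sub (h g 1 1), h g 0 1, h g 1 0⟩

/-- With integral trace and 2 a unit, integrality of the diagonal entries is the same as integrality
of their difference. -/
theorem vertex_mem_fixedVertices_iff (hϖ : Irreducible ϖ) (h2 : OrdEq ϖ 0 (2 : K))
    (hs : ∀ g, OrdGE ϖ 0 (σ g : Matrix (Fin 2) (Fin 2) K).trace) (P : GL (Fin 2) K) :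
    vertex O P ∈ fixedVertices O σ ↔ Level ϖ (conjRep σ P) 0 0 0 := by
  constructor
  · rintro ⟨L, hL, hst⟩
    obtain ⟨Q, rfl⟩ := exists_frameLattice_eq L
    refine Level.of_vertex_eq hϖ (P := Q) (level_of_integral fun g => ?_) hL
    rw [conjRep_apply]
    exact (mulVec_mem_frameLattice_iff ϖ).1 (hst _ ⟨g, rfl⟩)
  · intro h
    refine ⟨frameLattice O P, rfl, ?_⟩
    rintro _ ⟨g, rfl⟩
    refine (mulVec_mem_frameLattice_iff ϖ).2 ?_
    rw [← conjRep_apply]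
    have ht := hs g
    rw [← trace_conjRep σ P, trace_fin_two] at ht
    intro i j
    fin_cases i <;> fin_cases j
    · refine OrdGE.of_mul_left (k := 0) hϖ h2 ?_ (by omega)
      have := ht.add (h g).1
      rw [diff] at this
      convert this using 1
      simp only [Fin.zero_eta]
      ring
    · exact (h g).2.1
    · exact (h g).2.2
    · refine OrdGE.of_mul_left (k := 0) hϖ h2 ?_ (by omega)
      have := ht.sub (h g).1
      rw [diff] at this
      convert this using 1
      simp only [Fin.mk_one]
      ring

theorem Level.conj_mul_shift (hϖ : Irreducible ϖ) {a b d b' d' : ℤ}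
    (h : Level ϖ (conjRep σ P) a b d) (n : ℤ) (hb : b' = b + n) (hd : d' = d - n) :
    Level ϖ (conjRep σ (P * shift hϖ n)) a b' d' := by
  rw [conjRep_mul]
  exact h.conj_shift hϖ n hb hd

theorem mul_shift_mul_shift (hϖ : Irreducible ϖ) (P : GL (Fin 2) K) {m n k : ℤ} (h : k = m + n) :
    P * shift hϖ m * shift hϖ n = P * shift hϖ k := by
  rw [mul_assoc, ← shift_add, h]

/-- The ball of radius `c` around a vertex of level `c` is fixed. -/
theorem level_zero_of_edist_le (hϖ : Irreducible ϖ) {R Q : GL (Fin 2) K}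
    (h : Level ϖ (conjRep σ R) c c c)
    (hd : (tree O K).edist (vertex O R) (vertex O Q) ≤ c) : Level ϖ (conjRep σ Q) 0 0 0 := by
  obtain ⟨k, e, hk, hv, he⟩ := exists_frame_of_edist hϖ R (vertex O Q)
  rw [he] at hd
  have hec : e ≤ c := by exact_mod_cast hd
  have h1 : Level ϖ (conjRep σ (R * k)) c c c := by
    rw [conjRep_mul]
    exact h.of_isIntegralFrame hϖ hk
  exact ((h1.conj_mul_shift hϖ e rfl rfl).mono hϖ (by omega) (by omega)
    (by omega)).of_vertex_eq hϖ hv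

/-- A fixed vertex is at distance at most `c` from a vertex of level `c`. -/
theorem exists_level_of_level_zero (hϖ : Irreducible ϖ) {Q : GL (Fin 2) K}
    (hP : Level ϖ (conjRep σ P) c c c) (hQ : Level ϖ (conjRep σ Q) 0 0 0) :
    ∃ R, Level ϖ (conjRep σ R) c c c ∧ (tree O K).edist (vertex O Q) (vertex O R) ≤ c := by
  obtain ⟨k, e, hk, hv, he⟩ := exists_frame_of_edist hϖ Q (vertex O P)
  rcases le_or_gt e c with hec | hec
  · exact ⟨P, hP, by rw [he]; exact_mod_cast hec⟩
  have h1 : Level ϖ (conjRep σ (Q * k)) 0 0 0 := by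
    rw [conjRep_mul]
    exact hQ.of_isIntegralFrame hϖ hk
  have h2 := hP.of_vertex_eq hϖ hv.symm
  -- The vertex sought is `c` steps from `Q` towards `P`: seen from `P` its diagonal difference and
  -- lower left entry are small enough, seen from `Q` its upper right entry is.
  have h3 := h2.conj_mul_shift hϖ (c - e) rfl rfl
  rw [mul_shift_mul_shift hϖ (Q * k) (k := c) (by ring)] at h3
  have h4 := h1.conj_mul_shift hϖ c rfl rfl
  refine ⟨Q * k * shift hϖ c, fun g => ⟨(h3 g).1, (h4 g).2.1.mono hϖ (by omega),
    (h3 g).2.2.mono hϖ (by omega)⟩, ?_⟩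
  rw [← vertex_mul hϖ Q hk, edist_shift]

/-- The neighbour depends only on the line of the first column of `k` modulo `ϖ`. -/
theorem vertex_shift_one_eq (hϖ : Irreducible ϖ) (A : GL (Fin 2) K) {k : GL (Fin 2) K}
    (hk : IsIntegralFrame ϖ k) (h10 : OrdGE ϖ 1 (k 1 0)) :
    vertex O (A * k * shift hϖ 1) = vertex O (A * shift hϖ 1) := by
  have hϖ0 := algebraMap_uniformizer_ne_zero (K := K) hϖ
  have e : A * k * shift hϖ 1 = A * shift hϖ 1 * (shift hϖ (-1) * (k * shift hϖ 1)) := by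
    have : (shift hϖ 1 * shift hϖ (-1) : GL (Fin 2) K) = 1 := by
      rw [← shift_add]
      exact shift_zero hϖ
    rw [mul_assoc A (shift hϖ 1), ← mul_assoc (shift hϖ 1), this, one_mul, mul_assoc]
  have h0 (j : Fin 2) : (shift hϖ (-1) * (k * shift hϖ 1) : GL (Fin 2) K) 0 j =
      ![k 0 0, k 0 1 * algebraMap O K ϖ] j := by
    simp only [GeneralLinearGroup.coe_mul, coe_shift, mul_apply, Fin.sum_univ_two]
    fin_cases j <;> simp
  have h1 (j : Fin 2) : (shift hϖ (-1) * (k * shift hϖ 1) : GL (Fin 2) K) 1 j =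
      ![(algebraMap O K ϖ)⁻¹ * k 1 0, k 1 1] j := by
    simp only [GeneralLinearGroup.coe_mul, coe_shift, mul_apply, Fin.sum_univ_two]
    fin_cases j
    · simp
    · simp
      field_simp
  rw [e]
  refine vertex_mul hϖ _ ⟨fun i j => ?_, ?_⟩
  · fin_cases i
    · simp only [Fin.zero_eta, h0]
      fin_cases j
      · exact hk.1 0 0
      · exact (hk.1 0 1).mul_of_eq hϖ (OrdGE.of_int ϖ) (by ring)
    · simp only [Fin.mk_one, h1]
      fin_cases j
      · exact (ordEq_unif (K := K) hϖ).inv.ordGE.mul_of_eq hϖ h10 (by ring)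
      · exact hk.1 1 1
  · have := hk.2
    rw [h0, h0, h1, h1]
    simp only [cons_val_zero, cons_val_one]
    convert this using 1
    field_simp

/-- Exchanging the basis vectors reverses the apartment, up to homothety. -/
theorem vertex_swap_shift_one (hϖ : Irreducible ϖ) (A : GL (Fin 2) K) :
    vertex O (A * swap * shift hϖ 1) = vertex O (A * shift hϖ (-1)) := by
  have e : A * swap * shift hϖ 1 * swap =
      GeneralLinearGroup.scalar (Fin 2) (unif K hϖ) * (A * shift hϖ (-1)) := by
    rw [← mul_assoc, GeneralLinearGroup.scalar_commute, mul_assoc A, mul_assoc A, mul_assoc A,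
      GeneralLinearGroup.scalar_commute]
    congr 1
    apply Units.ext
    have hϖ0 := algebraMap_uniformizer_ne_zero (K := K) hϖ
    simp only [GeneralLinearGroup.coe_mul, coe_swap, coe_shift, GeneralLinearGroup.coe_scalar]
    ext i j
    fin_cases i <;> fin_cases j <;> simp [unif, hϖ0, Algebra.smul_def]
  rw [← vertex_mul hϖ _ isIntegralFrame_swap, e, vertex_scalar_mul]

/-- Every vertex of level `c` lies on the nerve. -/
theorem IsExtremal.exists_vertex_shift_eq (hE : IsExtremal ϖ σ P c l) (hϖ : Irreducible ϖ)
    {Q : GL (Fin 2) K} (hQ : Level ϖ (conjRep σ Q) c c c) :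
    ∃ i : ℕ, i ≤ l ∧ vertex O (P * shift hϖ i) = vertex O Q := by
  have hex : ∃ e i : ℕ, i ≤ l ∧
      (tree O K).edist (vertex O (P * shift hϖ i)) (vertex O Q) = e := by
    obtain ⟨k, e, hk, hv, he⟩ := exists_frame_of_edist hϖ (P * shift hϖ (0 : ℕ)) (vertex O Q)
    exact ⟨e, 0, by omega, he⟩
  classical
  -- Position `i` of the nerve is taken closest to `Q`. If the distance `e` is positive, the first
  -- step towards `Q` cannot stay on the nerve; the direction of this step is the first column of
  -- `k`.
  obtain ⟨i, hil, hi⟩ := Nat.find_spec hex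
  have hmin := fun m => Nat.find_min hex (m := m)
  generalize Nat.find hex = e at hi hmin
  rcases Nat.eq_zero_or_pos e with rfl | he
  · exact ⟨i, hil, SimpleGraph.edist_eq_zero_iff.1 (by exact_mod_cast hi)⟩
  exfalso
  obtain ⟨k, e', hk, hv, he'⟩ := exists_frame_of_edist hϖ (P * shift hϖ i) (vertex O Q)
  obtain rfl : e' = e := by
    rw [hi] at he'
    exact_mod_cast he'.symm
  have closer {j : ℕ} (hj : j ≤ l)
      (h : vertex O (P * shift hϖ j) = vertex O (P * shift hϖ i * k * shift hϖ 1)) : False := by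
    refine hmin (e' - 1) (by omega) ⟨j, hj, ?_⟩
    have : P * shift hϖ i * k * shift hϖ e' =
        P * shift hϖ i * k * shift hϖ 1 * shift hϖ (e' - 1 : ℕ) := by
      rw [mul_shift_mul_shift hϖ _ (by push_cast [he]; ring)]
    rw [h, ← hv, this, edist_shift]
  have hL := hE.level_shift hϖ i
  have hR : Level ϖ (conjRep σ (P * shift hϖ i * k)) c (c - e') (c + e') := by
    have := (hQ.of_vertex_eq hϖ hv.symm).conj_mul_shift hϖ (-e') rfl rfl
    rw [mul_shift_mul_shift hϖ _ (add_neg_cancel _).symm, shift_zero, mul_one] at this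
    exact this.mono hϖ le_rfl (by omega) (by omega)
  set τ := conjRep σ (P * shift hϖ i) with hτ
  -- Level `c` at distance `e' ≥ 1` in this direction gives order `c + e'` for the lower left entry
  -- in the frame `k`. Only one extra order is needed.
  have hkey (g : G) : OrdGE ϖ (c + 1) (τ g 1 0 * (k 0 0 * k 0 0) - diff τ g * (k 0 0 * k 1 0) -
      τ g 0 1 * (k 1 0 * k 1 0)) := by
    rw [← conjRep_one_zero, hτ, ← conjRep_mul]
    exact hk.2.ordGE.mul_of_le hϖ (hR g).2.2 (by omega)
  have hLc : Level ϖ τ c c c := hL.mono hϖ le_rfl (by omega) (by omega)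
  have hnot (b d : ℤ) (hbd : b + d = 2 * c + l + 1) (P' : GL (Fin 2) K)
      (h : Level ϖ (conjRep σ P') c b d) : False :=
    hE.not_level_length _ (h.conj_mul_shift hϖ (c - b) (by ring) (by omega))
  -- At the end `i = l`, a lower triangular frame with the same first column keeps order `c + l` in
  -- the upper right and gains one in the lower left, so the nerve could be lengthened. `hi0` is the
  -- mirror image at `i = 0`, with the direction as second column.
  have hil' (h00 : OrdEq ϖ 0 (k 0 0)) : i < l := by
    by_contra hcon
    obtain rfl : i = l := by omega
    have h0 := h00.ne_zero hϖ
    have hdet : k 0 0 * 1 - 0 * k 1 0 ≠ 0 := by simpa using h0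
    have hfr : IsIntegralFrame ϖ (gl (k 0 0) 0 (k 1 0) 1 hdet) := by
      constructor
      · intro i j
        fin_cases i <;> fin_cases j <;> simp [OrdGE.one, OrdGE.zero, hk.1]
      · simpa using h00
    refine hnot (c + i) (c + 1) (by ring) (P * shift hϖ i * gl (k 0 0) 0 (k 1 0) 1 hdet) ?_
    rw [conjRep_mul, ← hτ]
    intro g
    refine ⟨(hLc.of_isIntegralFrame hϖ hfr g).1, ?_, ?_⟩
    · refine OrdGE.of_mul_left (k := c + i) hϖ hfr.2 ?_ (by omega)
      rw [conjRep_zero_one]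
      simpa using (hL g).2.1
    · refine OrdGE.of_mul_left (k := c + 1) hϖ hfr.2 ?_ (by omega)
      rw [conjRep_one_zero]
      exact hkey g
  have hi0 (h10 : OrdEq ϖ 0 (k 1 0)) : 0 < i := by
    by_contra hcon
    obtain rfl : i = 0 := by omega
    have h0 := h10.ne_zero hϖ
    have hdet : 1 * k 1 0 - k 0 0 * 0 ≠ 0 := by simpa using h0
    have hfr : IsIntegralFrame ϖ (gl 1 (k 0 0) 0 (k 1 0) hdet) := by
      constructor
      · intro i j
        fin_cases i <;> fin_cases j <;> simp [OrdGE.one, OrdGE.zero, hk.1]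
      · simpa using h10
    refine hnot (c + 1) (c + l) (by ring) (P * shift hϖ (0 : ℕ) * gl 1 (k 0 0) 0 (k 1 0) hdet) ?_
    rw [conjRep_mul, ← hτ]
    intro g
    refine ⟨(hLc.of_isIntegralFrame hϖ hfr g).1, ?_, ?_⟩
    · refine OrdGE.of_mul_left (k := c + 1) hϖ hfr.2 ?_ (by omega)
      rw [conjRep_zero_one]
      convert (hkey g).neg using 1
      simp
      ring
    · refine OrdGE.of_mul_left (k := c + l) hϖ hfr.2 ?_ (by omega)
      rw [conjRep_one_zero]
      simpa using (hL g).2.2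
  -- Modulo `ϖ` the direction is the first basis line (towards `i + 1`), the second (towards `i -
  -- 1`), or neither. In the last case `0 < i < l`, so `β` and `γ` have order `c + 1`, and `hkey`
  -- forces the same on `x`, against the maximality of `c`.
  by_cases h10 : OrdGE ϖ 1 (k 1 0)
  · have h00 : OrdEq ϖ 0 (k 0 0) := by
      refine ordEq_of_not_succ hϖ (hk.1 0 0) fun h => hk.2.not_succ hϖ ?_
      exact (h.mul_of_le hϖ (hk.1 ..) (by omega)).sub
        ((hk.1 ..).mul_of_le hϖ h10 (by omega))
    refine closer (j := i + 1) (by have := hil' h00; omega) ?_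
    rw [vertex_shift_one_eq hϖ _ hk h10, mul_shift_mul_shift hϖ P rfl, Nat.cast_add, Nat.cast_one]
  have h10u : OrdEq ϖ 0 (k 1 0) := ordEq_of_not_succ hϖ (hk.1 1 0) (by simpa using h10)
  have hi0' := hi0 h10u
  by_cases h00 : OrdGE ϖ 1 (k 0 0)
  · refine closer (j := i - 1) (by omega) ?_
    have hsw : (swap * k : GL (Fin 2) K) 1 0 = k 0 0 := by
      rw [GeneralLinearGroup.coe_mul, coe_swap, mul_apply, Fin.sum_univ_two]
      simp
    have e1 : P * shift hϖ i * k = P * shift hϖ i * swap * (swap * k) := by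
      rw [mul_assoc _ swap, ← mul_assoc swap, swap_mul_swap, one_mul]
    rw [e1, vertex_shift_one_eq hϖ _ (isIntegralFrame_swap.mul hϖ hk) (by rwa [hsw]),
      vertex_swap_shift_one, mul_shift_mul_shift hϖ P (k := (i - 1 : ℕ)) (by omega)]
  have h00u : OrdEq ϖ 0 (k 0 0) := ordEq_of_not_succ hϖ (hk.1 0 0) (by simpa using h00)
  have hil'' := hil' h00u
  refine hE.not_level_succ (P * shift hϖ i) fun g => ?_
  have hβ : OrdGE ϖ (c + 1) (τ g 0 1) := (hL g).2.1.mono hϖ (by omega)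
  have hγ : OrdGE ϖ (c + 1) (τ g 1 0) := (hL g).2.2.mono hϖ (by omega)
  refine ⟨OrdGE.of_mul_left (k := c + 1) hϖ (h00u.mul hϖ h10u) ?_ (by omega), hβ, hγ⟩
  have e : k 0 0 * k 1 0 * diff τ g = τ g 1 0 * (k 0 0 * k 0 0) - τ g 0 1 * (k 1 0 * k 1 0) -
      (τ g 1 0 * (k 0 0 * k 0 0) - diff τ g * (k 0 0 * k 1 0) - τ g 0 1 * (k 1 0 * k 1 0)) := by
    ring
  rw [← hτ, e]
  exact ((hγ.mul_of_eq hϖ ((hk.1 ..).mul hϖ (hk.1 ..)) (by ring)).sub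
    (hβ.mul_of_eq hϖ ((hk.1 ..).mul hϖ (hk.1 ..)) (by ring))).sub (hkey g)

theorem IsExtremal.fixedVertices_eq_band (hE : IsExtremal ϖ σ P c l) (hϖ : Irreducible ϖ)
    (h2 : OrdEq ϖ 0 (2 : K)) (hs : ∀ g, OrdGE ϖ 0 (σ g : Matrix (Fin 2) (Fin 2) K).trace) :
    fixedVertices O σ =
      band {z : Vertex O K | ∃ i : ℕ, i ≤ l ∧ vertex O (P * shift hϖ i) = z} c := by
  have hP : Level ϖ (conjRep σ P) c c c := hE.level.mono hϖ le_rfl le_rfl (by omega)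
  ext x
  obtain ⟨Q, rfl⟩ := exists_vertex_eq x
  rw [vertex_mem_fixedVertices_iff hϖ h2 hs]
  constructor
  · intro hQ
    obtain ⟨R, hR, hd⟩ := exists_level_of_level_zero hϖ hP hQ
    exact ⟨vertex O R, hE.exists_vertex_shift_eq hϖ hR, hd⟩
  · rintro ⟨_, ⟨i, hi, rfl⟩, hd⟩
    rw [SimpleGraph.edist_comm] at hd
    exact level_zero_of_edist_le hϖ
      ((hE.level_shift hϖ i).mono hϖ le_rfl (by omega) (by omega)) hd

/-- Change of frame replacing the first basis vector by the sum of both. -/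
def lower : GL (Fin 2) K := gl 1 0 1 1 (by simp)

theorem coe_lower : ((lower : GL (Fin 2) K) : Matrix (Fin 2) (Fin 2) K) = !![1, 0; 1, 1] := rfl

theorem isIntegralFrame_lower : IsIntegralFrame ϖ (lower : GL (Fin 2) K) := by
  constructor
  · intro i j
    fin_cases i <;> fin_cases j <;> simp [coe_lower, OrdGE.one, OrdGE.zero]
  · simp [coe_lower, OrdEq.one]

theorem isIntegralFrame_one : IsIntegralFrame ϖ (1 : GL (Fin 2) K) := by
  constructor
  · intro i j
    fin_cases i <;> fin_cases j <;> simp [OrdGE.one, OrdGE.zero]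
  · simp [OrdEq.one]

/-- If the ball of radius `r` around a vertex is fixed, then the vertex has level `r`. -/
theorem level_of_ball (hϖ : Irreducible ϖ) {r : ℕ} {R : GL (Fin 2) K}
    (h : ∀ Q, (tree O K).edist (vertex O Q) (vertex O R) ≤ r → Level ϖ (conjRep σ Q) 0 0 0) :
    Level ϖ (conjRep σ R) r r r := by
  have key {k : GL (Fin 2) K} (hk : IsIntegralFrame ϖ k) (g : G) :
      OrdGE ϖ r (conjRep (conjRep σ R) k g 1 0) := by
    have h1 := h (R * k * shift hϖ r)
      (by rw [← vertex_mul hϖ R hk, SimpleGraph.edist_comm, edist_shift])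
    have h2 := h1.conj_mul_shift hϖ (-r) rfl rfl
    rw [mul_shift_mul_shift hϖ _ (add_neg_cancel _).symm, shift_zero, mul_one] at h2
    rw [← conjRep_mul]
    exact (h2 g).2.2.mono hϖ (by omega)
  intro g
  -- The three directions `e₁`, `e₂` and `e₁ + e₂` yield `γ`, `β` and `γ - x - β`.
  have hγ := key isIntegralFrame_one g
  have hβ := key isIntegralFrame_swap g
  have hx := key isIntegralFrame_lower g
  rw [conjRep_one] at hγ
  rw [conjRep_swap_one_zero] at hβ
  have e := conjRep_one_zero (conjRep σ R) lower g
  simp only [coe_lower, of_apply, cons_val', cons_val_zero, cons_val_one, cons_val_fin_one,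
    mul_one, sub_zero, one_mul] at e
  rw [e] at hx
  refine ⟨?_, hβ, hγ⟩
  have e' : diff (conjRep σ R) g = conjRep σ R g 1 0 - conjRep σ R g 0 1 -
      (conjRep σ R g 1 0 - diff (conjRep σ R) g - conjRep σ R g 0 1) := by ring
  rw [e']
  exact (hγ.sub hβ).sub hx

/-- A vertex close to the end of a branch lies in this branch. -/
theorem inBranch_of_edist_lt (hϖ : Irreducible ϖ) {R : GL (Fin 2) K} {r : ℕ} (hr : r < c)
    {s : Vertex O K} (hs : (tree O K).edist (vertex O (R * shift hϖ c)) s ≤ r) :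
    InBranch ϖ R s ∧ s ≠ vertex O R := by
  obtain ⟨w, hw⟩ := SimpleGraph.exists_walk_of_edist_ne_top (ne_top_of_le_ne_top (by simp) hs)
  have hwr : w.length ≤ r := by
    rw [← hw] at hs
    exact_mod_cast hs
  -- A walk of length at most `r < c` is too short to reach the root at distance `c`, so it stays in
  -- the branch.
  have hne (i : ℕ) (hi : i ≤ w.length) : w.getVert i ≠ vertex O R := by
    intro h
    have h1 := SimpleGraph.edist_le (w.take i)
    rw [SimpleGraph.Walk.take_length, h, SimpleGraph.edist_comm, edist_shift] at h1
    have : c ≤ min i w.length := by exact_mod_cast h1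
    omega
  have hend : w.getVert w.length = s := w.getVert_length
  constructor
  · have := InBranch.getVert hϖ (P := R) w (Nat.zero_le _) le_rfl
      (by rw [SimpleGraph.Walk.getVert_zero]; exact inBranch_shift hϖ R (by omega))
      fun i _ hi => hne i hi
    rwa [hend] at this
  · have := hne _ le_rfl
    rwa [hend] at this

/-- A walk between two disjoint branches at one vertex must visit that vertex in between, since each
branch can be left only there. -/
theorem exists_getVert_eq (hϖ : Irreducible ϖ) {A B : GL (Fin 2) K}
    (hAB : vertex O A = vertex O B)
    (hdisj : ∀ y : Vertex O K, InBranch ϖ A y → InBranch ϖ B y → False) {x y : Vertex O K}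
    (p : (tree O K).Walk x y) {a b : ℕ} (ha : a ≤ p.length) (hb : b ≤ p.length)
    (hA : InBranch ϖ A (p.getVert a)) (hB : InBranch ϖ B (p.getVert b)) :
    ∃ t ≤ p.length, p.getVert t = vertex O A ∧ (a ≤ t ∧ t ≤ b ∨ b ≤ t ∧ t ≤ a) := by
  by_contra! hcon
  rcases le_total a b with h | h
  · refine hdisj _ (hA.getVert hϖ p h hb fun i h1 h2 h3 => ?_) hB
    exact absurd h2 (not_le.2 ((hcon i (by omega) h3).1 h1))
  · refine hdisj _ hA (hB.getVert hϖ p h ha fun i h1 h2 h3 => ?_)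
    exact absurd h2 (not_le.2 ((hcon i (by omega) (h3.trans hAB.symm)).2 h1))

/-- The radius of a band is determined by its set of vertices. -/
theorem IsExtremal.eq_of_isBandOfRadius (hE : IsExtremal ϖ σ P c l) (hϖ : Irreducible ϖ)
    (h2 : OrdEq ϖ 0 (2 : K)) (hs : ∀ g, OrdGE ϖ 0 (σ g : Matrix (Fin 2) (Fin 2) K).trace) {r : ℕ}
    (h : IsBandOfRadius (fixedVertices O σ) r) : r = c := by
  obtain ⟨S, ⟨x, y, p, hp, rfl⟩, hband⟩ := h
  apply le_antisymm
  · by_contra! hcr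
    obtain ⟨R, rfl⟩ := exists_vertex_eq x
    refine hE.not_level_succ R ((level_of_ball (r := r) hϖ fun Q hQ => ?_).mono hϖ (by omega)
      (by omega) (by omega))
    rw [← vertex_mem_fixedVertices_iff hϖ h2 hs, hband]
    exact ⟨_, p.start_mem_support, hQ⟩
  · by_contra! hrc
    have hP : Level ϖ (conjRep σ P) c c c := hE.level.mono hϖ le_rfl le_rfl (by omega)
    -- The fixed vertex `c` steps from `P` in any direction is within `r < c` of the segment, so the
    -- segment enters the branch in that direction.
    have key {k : GL (Fin 2) K} (hk : IsIntegralFrame ϖ k) :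
        ∃ a ≤ p.length, InBranch ϖ (P * k) (p.getVert a) ∧ p.getVert a ≠ vertex O P := by
      have hv := vertex_mul (O := O) hϖ P hk
      have hmem : vertex O (P * k * shift hϖ c) ∈ fixedVertices O σ := by
        rw [vertex_mem_fixedVertices_iff hϖ h2 hs]
        exact level_zero_of_edist_le hϖ hP (by rw [← hv, edist_shift])
      rw [hband] at hmem
      obtain ⟨s, hsp, hd⟩ := hmem
      obtain ⟨a, rfl, ha⟩ := SimpleGraph.Walk.mem_support_iff_exists_getVert.1 hsp
      have := inBranch_of_edist_lt hϖ hrc hd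
      rw [hv] at this
      exact ⟨a, ha, this⟩
    obtain ⟨a₁, ha₁, hB₁, hne₁⟩ := key isIntegralFrame_one
    obtain ⟨a₂, ha₂, hB₂, hne₂⟩ := key isIntegralFrame_swap
    obtain ⟨a₃, ha₃, hB₃, hne₃⟩ := key isIntegralFrame_lower
    rw [mul_one] at hB₁
    have hv₂ := vertex_mul (O := O) hϖ P isIntegralFrame_swap
    have hv₃ := vertex_mul (O := O) hϖ P isIntegralFrame_lower
    obtain ⟨t₁, ht₁, he₁, hb₁⟩ := exists_getVert_eq hϖ hv₂.symm
      (fun y => InBranch.disjoint hϖ isIntegralFrame_swap (by simp [coe_swap, OrdEq.one]))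
      p ha₁ ha₂ hB₁ hB₂
    obtain ⟨t₂, ht₂, he₂, hb₂⟩ := exists_getVert_eq hϖ hv₃.symm
      (fun y => InBranch.disjoint hϖ isIntegralFrame_lower (by simp [coe_lower, OrdEq.one]))
      p ha₁ ha₃ hB₁ hB₃
    have hsl : P * lower = P * swap * (swap * lower) := by
      rw [mul_assoc, ← mul_assoc swap, swap_mul_swap, one_mul]
    obtain ⟨t₃, ht₃, he₃, hb₃⟩ := exists_getVert_eq hϖ (hv₂.trans hv₃.symm)
      (fun y h h' => by
        rw [hsl] at h'
        refine InBranch.disjoint hϖ (isIntegralFrame_swap.mul hϖ isIntegralFrame_lower) ?_ h h'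
        rw [GeneralLinearGroup.coe_mul, coe_swap, coe_lower, mul_apply, Fin.sum_univ_two]
        simp [OrdEq.one])
      p ha₂ ha₃ hB₂ hB₃
    rw [hv₂] at he₃
    -- A path visits `P` only once, at time `t₁`. This time would have to separate each two of the
    -- three times `a₁`, `a₂`, `a₃`, which is impossible on a line.
    obtain rfl : t₁ = t₂ := hp.getVert_injOn ht₁ ht₂ (he₁.trans he₂.symm)
    obtain rfl : t₁ = t₃ := hp.getVert_injOn ht₁ ht₃ (he₁.trans he₃.symm)
    have n₁ : t₁ ≠ a₁ := fun h => hne₁ (h ▸ he₁)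
    have n₂ : t₁ ≠ a₂ := fun h => hne₂ (h ▸ he₁)
    have n₃ : t₁ ≠ a₃ := fun h => hne₃ (h ▸ he₁)
    omega

/-- Fixed vertices at distance `e` give level `(0, 0, e)`, hence a conjugate pair modulo `ϖ ^ e` and
`e ≤ 2c + l`. The apartment segment joining them is fixed, so the distance in the induced graph is
no larger. Positions `-c` and `c + l` attain the bound. -/
theorem IsExtremal.ediam_fixedGraph [IsAdicComplete (maximalIdeal O) O]
    (hE : IsExtremal ϖ σ P c l) (hϖ : Irreducible ϖ)
    (hchar : ringChar (ResidueField O) ≠ 2) (hirr : NoStableLine σ)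
    (hs : ∀ g, OrdGE ϖ 0 (σ g : Matrix (Fin 2) (Fin 2) K).trace) :
    (fixedGraph O σ).ediam = (2 * c + l : ℕ) := by
  have h2 : OrdEq ϖ 0 (2 : K) := ordEq_two hchar
  have hmem := vertex_mem_fixedVertices_iff (O := O) hϖ h2 hs
  apply le_antisymm
  · refine SimpleGraph.ediam_le_of_edist_le ?_
    rintro ⟨u, hu⟩ ⟨v, hv⟩
    obtain ⟨Q, rfl⟩ := exists_vertex_eq u
    obtain ⟨k, e, hk, rfl, -⟩ := exists_frame_of_edist hϖ Q v
    have hvk := vertex_mul (O := O) hϖ Q hk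
    have h1 : Level ϖ (conjRep σ (Q * k)) 0 0 0 := by
      rw [← hmem, hvk]
      exact hu
    have h3 : Level ϖ (conjRep σ (Q * k)) 0 0 e := by
      have := ((hmem _).1 hv).conj_mul_shift hϖ (-e) rfl rfl
      rw [mul_shift_mul_shift hϖ _ (add_neg_cancel _).symm, shift_zero, mul_one] at this
      exact fun g => ⟨(h1 g).1, (h1 g).2.1, (this g).2.2.mono hϖ (by omega)⟩
    obtain ⟨χ₁, χ₂, hχ⟩ := h3.exists_isConjugatePair hϖ hchar
      (by simpa only [trace_conjRep] using hs)
    have hle := hE.le_of_isConjugatePair hϖ hchar hirr (isConjugatePair_conjRep.1 hχ)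
    -- Truncation at `e` makes the chain a total function on the naturals.
    have hf (i : ℕ) : vertex O (Q * k * shift hϖ (min i e : ℕ)) ∈ fixedVertices O σ := by
      rw [hmem]
      exact (h3.conj_mul_shift hϖ (min i e : ℕ) rfl rfl).mono hϖ le_rfl (by omega) (by omega)
    obtain ⟨w, hw, -⟩ := exists_walk_of_chain (fixedGraph O σ) (fun i => ⟨_, hf i⟩) e
      fun i hi => by
        change (tree O K).Adj (vertex O _) (vertex O _)
        rw [min_eq_left hi.le, min_eq_left (Nat.succ_le_of_lt hi)]
        exact adj_shift_succ hϖ _ i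
    have hd := SimpleGraph.edist_le w
    rw [hw] at hd
    have e0 : (⟨_, hf 0⟩ : fixedVertices O σ) = ⟨vertex O Q, hu⟩ := by
      apply Subtype.ext
      change vertex O _ = _
      rw [Nat.zero_min, Nat.cast_zero, shift_zero, mul_one, hvk]
    have e1 : (⟨_, hf e⟩ : fixedVertices O σ) = ⟨vertex O (Q * k * shift hϖ e), hv⟩ := by
      apply Subtype.ext
      change vertex O _ = _
      rw [min_self]
    rw [← e0, ← e1]
    exact hd.trans (by exact_mod_cast hle)
  · have hu : vertex O (P * shift hϖ (-c)) ∈ fixedVertices O σ := by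
      rw [hmem]
      exact (hE.level_shift hϖ (-c)).mono hϖ (by omega) (by omega) (by omega)
    have hv : vertex O (P * shift hϖ (-c) * shift hϖ (2 * c + l : ℕ)) ∈ fixedVertices O σ := by
      rw [hmem, mul_shift_mul_shift hϖ P rfl]
      exact (hE.level_shift hϖ _).mono hϖ (by omega) (by push_cast; omega) (by push_cast; omega)
    refine le_trans ?_ (SimpleGraph.edist_le_ediam (u := ⟨_, hu⟩) (v := ⟨_, hv⟩))
    refine le_iInf fun q => ?_
    have := (le_length_of_walk hϖ
      (q.map (SimpleGraph.Embedding.induce (fixedVertices O σ)).toHom)).trans_eq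
        (SimpleGraph.Walk.length_map _ _)
    exact_mod_cast this

end Nerve

end BTTree

/-! ### The main theorem -/

theorem theorem4p1 {O K G : Type*} [CommRing O] [IsDomain O] [IsDiscreteValuationRing O]
    [IsAdicComplete (IsLocalRing.maximalIdeal O) O]
    [Field K] [Algebra O K] [IsFractionRing O K]
    (hchar : ringChar (IsLocalRing.ResidueField O) ≠ 2)
    [Group G] (ρ : G →* Matrix.GeneralLinearGroup (Fin 2) K)
    (hstable : BTTree.HasStableLattice O ρ)
    (hirr : (BTTree.toRepresentation ρ).IsIrreducible) :
    BTTree.indexN O ρ ≠ ⊤ ∧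
    (BTTree.fixedGraph O ρ).ediam = BTTree.indexN O ρ ∧
    (∃ r : ℕ, BTTree.IsBandOfRadius (BTTree.fixedVertices O ρ) r) ∧
    ∀ r : ℕ, BTTree.IsBandOfRadius (BTTree.fixedVertices O ρ) r →
      ((BTTree.indexM O ρ : ℕ∞) ≠ BTTree.indexN O ρ → r = BTTree.indexM O ρ) ∧
      ((BTTree.indexM O ρ : ℕ∞) = BTTree.indexN O ρ → r = BTTree.indexM O ρ / 2) := by
  obtain ⟨ϖ, hϖ⟩ := IsDiscreteValuationRing.exists_irreducible O
  have h2 : BTTree.OrdEq ϖ 0 (2 : K) := BTTree.ordEq_two hchar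
  have hline := BTTree.noStableLine_of_isIrreducible hirr
  obtain ⟨L, hL⟩ := hstable
  obtain ⟨P₀, rfl⟩ := BTTree.exists_frameLattice_eq L
  have hint (g : G) (i j : Fin 2) : BTTree.OrdGE ϖ 0 (BTTree.conjRep ρ P₀ g i j) := by
    rw [BTTree.conjRep_apply]
    exact (BTTree.mulVec_mem_frameLattice_iff ϖ).1 (hL g) i j
  have hs (g : G) : BTTree.OrdGE ϖ 0 (ρ g : Matrix (Fin 2) (Fin 2) K).trace := by
    rw [← BTTree.trace_conjRep ρ P₀, Matrix.trace_fin_two]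
    exact (hint g 0 0).add (hint g 1 1)
  have hd (g : G) : BTTree.OrdGE ϖ 0 (ρ g : Matrix (Fin 2) (Fin 2) K).det := by
    rw [← BTTree.det_conjRep P₀, Matrix.det_fin_two]
    exact ((hint g 0 0).mul_of_eq hϖ (hint g 1 1) (by ring)).sub
      ((hint g 0 1).mul_of_eq hϖ (hint g 1 0) (by ring))
  obtain ⟨P, c, l, hE⟩ := BTTree.exists_isExtremal hϖ hchar hline
    ⟨P₀, BTTree.level_of_integral hint⟩
  have hN := hE.indexN_eq hϖ hchar hline hs
  refine ⟨by rw [hN]; exact ENat.natCast_ne_top _, by rw [hN, hE.ediam_fixedGraph hϖ hchar hline hs],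
    ⟨c, _, BTTree.isSegment_shift hϖ P l, hE.fixedVertices_eq_band hϖ h2 hs⟩, fun r hr => ?_⟩
  obtain rfl := hE.eq_of_isBandOfRadius hϖ h2 hs hr
  rw [hN]
  -- In the first case `l ≥ 1` excludes `m(ρ) = n(ρ)`; in the second `l ≤ 1` makes the integer part
  -- of `(2r + l) / 2` equal to `r`.
  rcases hE.indexM_eq hϖ hchar hline hs hd with ⟨hl, hM⟩ | ⟨hl, hM⟩ <;> rw [hM]
  · refine ⟨fun _ => rfl, fun h => ?_⟩
    have : r = 2 * r + l := by exact_mod_cast h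
    omega
  · refine ⟨fun h => absurd rfl h, fun _ => ?_⟩
    omega
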